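/- For a 3-CNF $f:\{0,1\}^n\to\{0,1\}$ (a conjunction of $m$ clauses, each a disjunction of three literals) with $n\le 3m$, let $gap(f)=\sum_{x\in\{0,1\}^n}(-1)^{f(x)}$. Assume the following conjecture: every non-deterministic algorithm that, given a description of such an $f$ with $m$ clauses, decides whether $gap(f)\neq0$ or $gap(f)=0$ (accepting on some computation path if and only if $gap(f)\ne0$) needs $2^{\Omega(m)}$ time, in the sense that its running time is not $2^{o(m)}$: for every time bound $T(m)$ on all its computation paths there is a constant $c>0$ with $T(m)\ge 2^{cm}$ for infinitely many $m$. Let Clifford-$T$ circuits be the quantum circuits over the gates $H$, $S=|0\rangle\langle0|+i|1\rangle\langle1|$, $CZ$ and $T=|0\rangle\langle0|+e^{i\pi/4}|1\rangle\langle1|$, and for an $N$-qubit circuit $V$ let $p_{acc}(V)=|\langle0^N|V|0^N\rangle|^2$. A classical probabilistic algorithm, given a description of $V$, samples $p_{acc}(V)$ in time $T$ within multiplicative error $\epsilon$ if all its computation paths halt within $T$ steps and it accepts with a probability $q_{acc}$ such that $|p_{acc}(V)-q_{acc}|\le\epsilon\, p_{acc}(V)$. Then for infinitely many $t$ there exists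 a Clifford-$T$ circuit $V_t$ with exactly $t$ $T$ gates, whose size (number of qubits plus number of gates) is bounded by a polynomial in $t$, such that the acceptance probability of $V_t$ cannot be classically sampled in $2^{o(t)}$ time within a multiplicative error $\epsilon<1$: for every $\epsilon<1$, every classical probabilistic algorithm and every time bound $\tau(t)=2^{o(t)}$, there are infinitely many of these $t$ for which the algorithm, given the description of $V_t$, does not sample $p_{acc}(V_t)$ in time $\tau(t)$ within multiplicative error $\epsilon$. -/

import Mathlib

namespace FineGrained

/-! ### The machine model

Classical machines are multi-stack machines (equivalently, multi-tape Turing machines, a tape being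
two stacks) over the binary alphabet, with a finite structured control and the possibility of
branching on one fresh bit per step.  The fresh bits are read as guesses (non-deterministic
machines) or as fair coin flips (probabilistic machines). -/

/-- Control programs of multi-stack machines.  A program mentions only finitely many of the stacks
`0, 1, 2, …`, each of which holds a finite bit string.
* `skip` does nothing;
* `push s b` pushes the bit `b` on stack `s`;
* `pop s p q r` continues with `p` if stack `s` is empty, and otherwise removes its top bit and
  continues with `q` if that bit was `false`, with `r` if it was `true`;
* `flip p q` continues with `p` or `q` according to the fresh bit of the current step;
* `seq p q` is sequential composition;
* `loop s p` repeats `p` as long as stack `s` is nonempty. -/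
inductive Prog : Type
  | skip : Prog
  | push (s : ℕ) (b : Bool) : Prog
  | pop (s : ℕ) (p q r : Prog) : Prog
  | flip (p q : Prog) : Prog
  | seq (p q : Prog) : Prog
  | loop (s : ℕ) (p : Prog) : Prog

/-- A configuration: the commands that remain to be executed, and the contents of the stacks (the
head of a list is the top of the stack). -/
structure Config : Type where
  code : List Prog
  mem : ℕ → List Bool

/-- One computation step; `b` is the fresh bit of this step.  Halted configurations do not move. -/
def Config.step (b : Bool) : Config → Config
  | ⟨[], σ⟩ => ⟨[], σ⟩
  | ⟨.skip :: k, σ⟩ => ⟨k, σ⟩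
  | ⟨.push s a :: k, σ⟩ => ⟨k, Function.update σ s (a :: σ s)⟩
  | ⟨.pop s p q r :: k, σ⟩ =>
    match σ s with
    | [] => ⟨p :: k, σ⟩
    | false :: l => ⟨q :: k, Function.update σ s l⟩
    | true :: l => ⟨r :: k, Function.update σ s l⟩
  | ⟨.flip p q :: k, σ⟩ => ⟨(if b then q else p) :: k, σ⟩
  | ⟨.seq p q :: k, σ⟩ => ⟨p :: q :: k, σ⟩
  | ⟨.loop s p :: k, σ⟩ =>
    match σ s with
    | [] => ⟨k, σ⟩
    | _ :: _ => ⟨p :: .loop s p :: k, σ⟩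

/-- The configuration after as many steps as there are bits in `w`, these being the fresh bits. -/
def Config.run (c : Config) (w : List Bool) : Config :=
  w.foldl (fun d b => d.step b) c

/-- A configuration has halted if no command remains. -/
def Config.Halted (c : Config) : Prop := c.code = []

/-- A configuration is accepting if it has halted with the bit `true` on top of stack `0`. -/
def Config.Accepting (c : Config) : Prop := c.Halted ∧ (c.mem 0).head? = some true

/-- The initial configuration: the input is on stack `0`, and the other stacks are empty. -/
def Prog.init (M : Prog) (x : List Bool) : Config :=
  ⟨[M], fun s => if s = 0 then x else []⟩

/-- On input `x`, every computation path of `M` halts within `T` steps. -/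
def Prog.HaltsWithin (M : Prog) (x : List Bool) (T : ℕ) : Prop :=
  ∀ w : Fin T → Bool, ((M.init x).run (List.ofFn w)).Halted

/-- Non-deterministic acceptance: some computation path of length at most `T` accepts `x`. -/
def Prog.NDAccepts (M : Prog) (x : List Bool) (T : ℕ) : Prop :=
  ∃ w : Fin T → Bool, ((M.init x).run (List.ofFn w)).Accepting

open Classical in
/-- The probability that `M`, with fair coin flips, has accepted `x` within `T` steps. -/
noncomputable def Prog.acceptProb (M : Prog) (x : List Bool) (T : ℕ) : ℝ :=
  (Finset.univ.filter fun w : Fin T → Bool =>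
    ((M.init x).run (List.ofFn w)).Accepting).card / 2 ^ T

/-- The time bound `τ` is `2^{o(t)}`. -/
def SubExponential (τ : ℕ → ℕ) : Prop :=
  ∃ g : ℕ → ℝ, g =o[Filter.atTop] (fun t : ℕ => (t : ℝ)) ∧ ∀ t, (τ t : ℝ) ≤ (2 : ℝ) ^ g t

/-- Self-delimiting unary code of a natural number. -/
def unary (k : ℕ) : List Bool := List.replicate k true ++ [false]

/-! ### 3-CNFs, the gap function, and the conjecture -/

/-- A literal: a variable, negated if `neg` is `true`. -/
structure Literal (n : ℕ) : Type where
  var : Fin n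
  neg : Bool

/-- A 3-CNF `f : {0,1}ⁿ → {0,1}`: a conjunction of clauses, each a disjunction of three literals. -/
structure CNF3 : Type where
  n : ℕ
  clauses : List (Literal n × Literal n × Literal n)

/-- The value of a literal. -/
def Literal.eval {n : ℕ} (l : Literal n) (x : Fin n → Bool) : Bool := xor l.neg (x l.var)

/-- The Boolean function of a 3-CNF. -/
def CNF3.eval (f : CNF3) (x : Fin f.n → Bool) : Bool :=
  f.clauses.all fun c => c.1.eval x || c.2.1.eval x || c.2.2.eval x

/-- The number `m` of clauses. -/
def CNF3.m (f : CNF3) : ℕ := f.clauses.length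

/-- `gap(f) = ∑_x (-1)^{f(x)}`. -/
def CNF3.gap (f : CNF3) : ℤ := ∑ x : Fin f.n → Bool, (-1) ^ (f.eval x).toNat

/-- The description of a literal. -/
def Literal.encode {n : ℕ} (l : Literal n) : List Bool := l.neg :: unary l.var

/-- The description of a 3-CNF as a bit string. -/
def CNF3.encode (f : CNF3) : List Bool :=
  unary f.n ++
    f.clauses.flatMap (fun c => true :: (c.1.encode ++ c.2.1.encode ++ c.2.2.encode)) ++ [false]

/-- The non-deterministic machine `M` decides in time `T(m)` whether `gap(f) ≠ 0` or `gap(f) = 0`,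
given a 3-CNF `f` with `m` clauses.  (A 3-CNF with `m` clauses has at most `3m` variables; without
`n ≤ 3m` the length of the input would not be bounded in terms of `m`.) -/
def DecidesGap (M : Prog) (T : ℕ → ℕ) : Prop :=
  ∀ f : CNF3, f.n ≤ 3 * f.m →
    M.HaltsWithin f.encode (T f.m) ∧ (M.NDAccepts f.encode (T f.m) ↔ f.gap ≠ 0)

/-- The conjecture: every non-deterministic algorithm that decides whether `gap(f) ≠ 0` or
`gap(f) = 0`, given a 3-CNF with `m` clauses, needs `2^{Ω(m)}` time.  The lower bound is asked for
infinitely many `m` only, that is, the time is not `2^{o(m)}`. -/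
def GapETHConjecture : Prop :=
  ∀ (M : Prog) (T : ℕ → ℕ), DecidesGap M T →
    ∃ c : ℝ, 0 < c ∧ ∃ᶠ m : ℕ in Filter.atTop, (2 : ℝ) ^ (c * m) ≤ T m

/-! ### Clifford+T circuits -/

/-- The gates `H`, `S`, `CZ` (Clifford gates) and `T` on `N` qubits. -/
inductive Gate (N : ℕ) : Type
  | H (i : Fin N) : Gate N
  | S (i : Fin N) : Gate N
  | CZ (i j : Fin N) (h : i ≠ j) : Gate N
  | T (i : Fin N) : Gate N

/-- The action of a gate on a vector `ψ = ∑_x ψ(x) |x⟩`. -/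
noncomputable def Gate.act {N : ℕ} (g : Gate N) (ψ : (Fin N → Bool) → ℂ) : (Fin N → Bool) → ℂ :=
  match g with
  | .H i => fun x => (1 / (Real.sqrt 2 : ℂ)) *
      (ψ (Function.update x i false) + (if x i then -1 else 1) * ψ (Function.update x i true))
  | .S i => fun x => (if x i then Complex.I else 1) * ψ x
  | .CZ i j _ => fun x => (if x i && x j then -1 else 1) * ψ x
  | .T i => fun x => (if x i then Complex.exp (Complex.I * Real.pi / 4) else 1) * ψ x

/-- A Clifford+T circuit: `N` qubits and a list of gates, the first one being applied first. -/
structure CliffordT : Type where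
  N : ℕ
  gates : List (Gate N)

/-- The basis vector `|0^N⟩`. -/
def zeroState (N : ℕ) : (Fin N → Bool) → ℂ :=
  fun x => if x = (fun _ => false) then 1 else 0

/-- The acceptance probability `p_acc = |⟨0^N| V |0^N⟩|²`. -/
noncomputable def CliffordT.pacc (V : CliffordT) : ℝ :=
  ‖(V.gates.foldl (fun ψ g => g.act ψ) (zeroState V.N)) (fun _ => false)‖ ^ 2

/-- Whether a gate is a `T` gate. -/
def Gate.isT {N : ℕ} : Gate N → Bool
  | .T _ => true
  | _ => false

/-- The number of `T` gates. -/
def CliffordT.tCount (V : CliffordT) : ℕ := V.gates.countP Gate.isT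

/-- The size of a circuit: number of qubits plus number of gates. -/
def CliffordT.size (V : CliffordT) : ℕ := V.N + V.gates.length

/-- The description of a gate. -/
def Gate.encode {N : ℕ} : Gate N → List Bool
  | .H i => false :: false :: unary i
  | .S i => false :: true :: unary i
  | .CZ i j _ => true :: false :: (unary i ++ unary j)
  | .T i => true :: true :: unary i

/-- The description of a circuit as a bit string. -/
def CliffordT.encode (V : CliffordT) : List Bool :=
  unary V.N ++ V.gates.flatMap (fun g => true :: g.encode) ++ [false]

/-- The probabilistic machine `M`, given the description of `V`, samples the acceptance probability
of `V` in time `T` within the multiplicative error `ε`: all its computation paths halt within `T`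
steps, and its own acceptance probability `q` satisfies `|p_acc - q| ≤ ε p_acc`. -/
def Samples (M : Prog) (V : CliffordT) (T : ℕ) (ε : ℝ) : Prop :=
  M.HaltsWithin V.encode T ∧ |V.pacc - M.acceptProb V.encode T| ≤ ε * V.pacc

end FineGrained

namespace FineGrained

/-! ### Deterministic runs of programs -/

/-! A sampler with multiplicative error below `1` accepts with probability zero exactly when `p_acc
= 0`. Reading its coin flips as guesses therefore gives a non-deterministic test for `p_acc ≠ 0`
(`Samples.detectsNonzero`). It remains to encode the gap of a 3-CNF with `m` clauses in an
amplitude, using `O(m)` `T` gates whatever the number of variables.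

The circuit is a layer of Hadamards, a diagonal circuit and another layer of Hadamards, so its
amplitude is `2^{-N}` times the sum of a phase over all bit assignments (`foldl_act_hadamards`).
Inside such a sum nothing has to be computed reversibly: an ancilla `z` occurring only through
`(-1)^{z·L}` contributes `2` if `L` is even and `0` otherwise, hence enforces a linear constraint
with `CZ` gates alone. Parities obtained in this way give `(-1)^{abc}` with seven `T` gates
(`bsum_ccz`), and three such phases annihilate the assignments violating a clause
(`bsum_clauseGates`). These constraints are switched on by a control bit `s`; the values `s = 0` and
`s = 1` carry weights in the ratio `1 : -2`, so the total is proportional to `2^n - 2·#f`, which is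
the gap (`bsum_diagGates`). Each clause costs `21` `T` gates and the weight costs `7`.

A concrete stack program writes the circuit from the formula in polynomial time
(`Prog.exec_transform`). Preceded by a lookup table for small formulas and followed by the sampler,
it decides the gap (`exists_decidesGap`), so the conjecture gives for each sampler some `c > 0` and
infinitely many `m` with an instance on which it fails below time `2^{cm}`
(`exists_frequently_hasHardInstance`). Programs are countable; a diagonal enumeration visiting each
one infinitely often merges these instances into a single sequence of circuits. -/

theorem Config.run_append (c : Config) (u w : List Bool) : c.run (u ++ w) = (c.run u).run w :=
  List.foldl_append

theorem Config.run_halted {c : Config} (h : c.Halted) (w : List Bool) : c.run w = c := by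
  induction w with
  | nil => rfl
  | cons b w ih =>
    obtain ⟨k, σ⟩ := c
    cases (show k = [] from h)
    exact ih

/-- Started on the memory `σ`, the program `p` terminates within `n` steps with the memory `σ'`,
whatever the fresh bits are. -/
def Prog.Exec (p : Prog) (σ σ' : ℕ → List Bool) (n : ℕ) : Prop :=
  ∃ t ≤ n, ∀ (k : List Prog) (w : List Bool), w.length = t →
    Config.run ⟨p :: k, σ⟩ w = ⟨k, σ'⟩

namespace Prog.Exec

variable {p q r : Prog} {σ σ' σ'' : ℕ → List Bool} {a b n : ℕ} {s : ℕ}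

theorem mono (h : Exec p σ σ' a) (hab : a ≤ b) : Exec p σ σ' b :=
  let ⟨t, ht, h⟩ := h
  ⟨t, ht.trans hab, h⟩

theorem of_step (h : ∀ (b : Bool) (k : List Prog), Config.step b ⟨p :: k, σ⟩ = ⟨k, σ'⟩) :
    Exec p σ σ' 1 := by
  refine ⟨1, le_rfl, fun k w hw => ?_⟩
  obtain ⟨b, rfl⟩ := List.length_eq_one_iff.1 hw
  exact h b k

theorem of_step_exec
    (h : ∀ (b : Bool) (k : List Prog), Config.step b ⟨p :: k, σ⟩ = ⟨q :: k, σ'⟩)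
    (hq : Exec q σ' σ'' n) : Exec p σ σ'' (n + 1) := by
  obtain ⟨t, ht, hq⟩ := hq
  refine ⟨t + 1, by omega, fun k w hw => ?_⟩
  obtain ⟨b, w, rfl⟩ := List.exists_of_length_succ w hw
  change Config.run (Config.step b ⟨p :: k, σ⟩) w = _
  rw [h]
  exact hq k w (by simpa using hw)

theorem of_step_exec_exec
    (h : ∀ (b : Bool) (k : List Prog), Config.step b ⟨r :: k, σ⟩ = ⟨p :: q :: k, σ⟩)
    (hp : Exec p σ σ' a) (hq : Exec q σ' σ'' b) : Exec r σ σ'' (a + b + 1) := by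
  obtain ⟨t, ht, hp⟩ := hp
  obtain ⟨u, hu, hq⟩ := hq
  refine ⟨t + u + 1, by omega, fun k w hw => ?_⟩
  obtain ⟨b, w, rfl⟩ := List.exists_of_length_succ w hw
  change Config.run (Config.step b ⟨r :: k, σ⟩) w = _
  have hw' : w.length = t + u := by simpa using hw
  rw [h, ← List.take_append_drop t w, Config.run_append, hp _ _ (by simp [hw']),
    hq _ _ (by simp [hw'])]

theorem skip : Exec .skip σ σ 1 := of_step fun _ _ => rfl

theorem push (s : ℕ) (b : Bool) : Exec (.push s b) σ (Function.update σ s (b :: σ s)) 1 :=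
  of_step fun _ _ => rfl

theorem pop_nil (hs : σ s = []) (h : Exec p σ σ' n) : Exec (.pop s p q r) σ σ' (n + 1) :=
  of_step_exec (fun b k => by simp [Config.step, hs]) h

theorem pop_false {l : List Bool} (hs : σ s = false :: l)
    (h : Exec q (Function.update σ s l) σ' n) : Exec (.pop s p q r) σ σ' (n + 1) :=
  of_step_exec (fun b k => by simp [Config.step, hs]) h

theorem pop_true {l : List Bool} (hs : σ s = true :: l)
    (h : Exec r (Function.update σ s l) σ' n) : Exec (.pop s p q r) σ σ' (n + 1) :=
  of_step_exec (fun b k => by simp [Config.step, hs]) h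

theorem seq (hp : Exec p σ σ' a) (hq : Exec q σ' σ'' b) : Exec (.seq p q) σ σ'' (a + b + 1) :=
  of_step_exec_exec (fun _ _ => rfl) hp hq

theorem loop_nil (hs : σ s = []) : Exec (.loop s p) σ σ 1 :=
  of_step fun b k => by simp [Config.step, hs]

theorem loop_cons (hs : σ s ≠ []) (hp : Exec p σ σ' a) (hl : Exec (.loop s p) σ' σ'' b) :
    Exec (.loop s p) σ σ'' (a + b + 1) := by
  refine of_step_exec_exec (fun b k => ?_) hp hl
  obtain ⟨x, l, hx⟩ := List.exists_cons_of_ne_nil hs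
  simp [Config.step, hx]

theorem _root_.FineGrained.Config.length_step_le (b : Bool) (c : Config) (s : ℕ) :
    ((c.step b).mem s).length ≤ (c.mem s).length + 1 := by
  obtain ⟨k, σ⟩ := c
  rcases k with - | ⟨p, k⟩
  · simp [Config.step]
  · cases p with
    | push u a =>
      by_cases h : s = u <;> simp [Config.step, h]
    | pop u p q r =>
      rcases h : σ u with - | ⟨x, l⟩
      · simp [Config.step, h]
      · by_cases hs : s = u <;> cases x <;>
          simp [Config.step, h, hs] <;> omega
    | loop u p => rcases h : σ u with - | ⟨x, l⟩ <;> simp [Config.step, h]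
    | _ => simp [Config.step]

theorem _root_.FineGrained.Config.length_run_le (c : Config) (w : List Bool) (s : ℕ) :
    ((c.run w).mem s).length ≤ (c.mem s).length + w.length := by
  induction w generalizing c with
  | nil => simp [Config.run]
  | cons b w ih =>
    have h₁ := ih (c.step b)
    have h₂ := c.length_step_le b s
    change (((c.step b).run w).mem s).length ≤ _
    simp only [List.length_cons]
    omega

/-- A stack grows by at most one bit per step. -/
theorem length_le (h : Exec p σ σ' n) (s : ℕ) : (σ' s).length ≤ (σ s).length + n := by
  obtain ⟨t, ht, h⟩ := h
  have h₁ := Config.length_run_le ⟨[p], σ⟩ (List.replicate t false) s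
  rw [h [] _ (by simp)] at h₁
  simp only [List.length_replicate] at h₁
  omega

end Prog.Exec

/-! ### Subroutines -/

/-- Push the bits of a word, the first one first. -/
def Prog.pushList (s : ℕ) : List Bool → Prog
  | [] => .skip
  | b :: l => .seq (.push s b) (pushList s l)

theorem Prog.exec_pushList (s : ℕ) (l : List Bool) (σ : ℕ → List Bool) :
    (Prog.pushList s l).Exec σ (Function.update σ s (l.reverse ++ σ s)) (2 * l.length + 1) := by
  induction l generalizing σ with
  | nil => simpa [Prog.pushList] using Prog.Exec.skip (σ := σ)
  | cons b l ih =>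
    have := (Prog.Exec.push (σ := σ) s b).seq (ih _)
    simp only [Function.update_idem, Function.update_self] at this
    simp only [List.reverse_cons, List.append_assoc, List.singleton_append, List.length_cons]
    exact this.mono (by omega)

/-- Move the contents of stack `s` onto stack `t`, reversing it. -/
def Prog.move (s t : ℕ) : Prog :=
  .loop s (.pop s .skip (.push t false) (.push t true))

theorem Prog.exec_move {s t : ℕ} (hst : s ≠ t) (σ : ℕ → List Bool) :
    (Prog.move s t).Exec σ (Function.update (Function.update σ s []) t ((σ s).reverse ++ σ t))
      (3 * (σ s).length + 1) := by
  generalize hl : σ s = l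
  induction l generalizing σ with
  | nil =>
    have : Function.update (Function.update σ s []) t ([].reverse ++ σ t) = σ := by
      funext i; simp only [Function.update_apply]; split_ifs <;> simp_all
    rw [this]
    exact Prog.Exec.loop_nil hl
  | cons b l ih =>
    have hb : (Prog.pop s .skip (.push t false) (.push t true)).Exec σ
        (Function.update (Function.update σ s l) t (b :: σ t)) 2 := by
      cases b
      · have := Prog.Exec.push (σ := Function.update σ s l) t false
        rw [Function.update_of_ne hst.symm] at this
        exact Prog.Exec.pop_false hl this
      · have := Prog.Exec.push (σ := Function.update σ s l) t true
        rw [Function.update_of_ne hst.symm] at this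
        exact Prog.Exec.pop_true hl this
    have h2 := ih (Function.update (Function.update σ s l) t (b :: σ t)) (by simp [hst])
    have h3 := Prog.Exec.loop_cons (by simp [hl]) hb h2
    have : Function.update (Function.update (Function.update (Function.update σ s l) t (b :: σ t))
        s []) t (l.reverse ++ Function.update (Function.update σ s l) t (b :: σ t) t) =
        Function.update (Function.update σ s []) t ((b :: l).reverse ++ σ t) := by
      funext i; simp only [Function.update_apply]; split_ifs <;> simp_all
    rw [this] at h3
    exact h3.mono (by simp; omega)

/-- Repeat `p`, removing a bit of stack `s` before each repetition, until stack `s` is empty. -/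
def Prog.drain (s : ℕ) (p : Prog) : Prog := .loop s (.pop s .skip p p)

/-- `drain` on a unary number, for an invariant `mem` indexed by the number of repetitions left. -/
theorem Prog.exec_drain {s : ℕ} {p : Prog} {c : ℕ} (mem : ℕ → ℕ → List Bool) (k : ℕ)
    (hs : ∀ i ≤ k, mem i s = List.replicate i true)
    (hp : ∀ i < k, p.Exec (Function.update (mem (i + 1)) s (List.replicate i true)) (mem i) c) :
    (Prog.drain s p).Exec (mem k) (mem 0) (k * (c + 2) + 1) := by
  induction k with
  | zero => simpa [Prog.drain] using Prog.Exec.loop_nil (p := .pop s .skip p p) (hs 0 le_rfl)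
  | succ k ih =>
    have hk := hs (k + 1) le_rfl
    have h1 := Prog.Exec.pop_true (p := .skip) (q := p) (hk.trans List.replicate_succ)
      (hp k (by omega))
    have h2 := ih (fun i hi => hs i (by omega)) (fun i hi => hp i (by omega))
    exact (Prog.Exec.loop_cons (by simp [hk]) h1 h2).mono (by ring_nf; omega)

/-- Write the number on stack `c` (in unary), increased by `r`, in unary to stack `o`; stack `4`
is used as scratch space. -/
def Prog.emitNat (o c r : ℕ) : Prog :=
  .seq (.drain c (.seq (.push 4 true) (.push o true)))
    (.seq (.move 4 c) (.pushList o (List.replicate r true ++ [false])))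

/-- Reading a unary counter destroys it, so each bit goes both to the output and to stack `4`, from
which the counter is restored. -/
theorem Prog.exec_emitNat {o c r k : ℕ} {σ : ℕ → List Bool} (ho : o ≠ 4) (hc : c ≠ 4)
    (hoc : o ≠ c) (h4 : σ 4 = []) (hk : σ c = List.replicate k true) :
    (Prog.emitNat o c r).Exec σ (Function.update σ o ((unary (k + r)).reverse ++ σ o))
      (8 * (k + r) + 7) := by
  -- Here `i` bits remain on the counter, and `k - i` have reached both stack `4` and the output.
  let mem : ℕ → ℕ → List Bool := fun i =>
    Function.update (Function.update (Function.update σ c (List.replicate i true))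
      4 (List.replicate (k - i) true)) o (List.replicate (k - i) true ++ σ o)
  have h1 : (Prog.drain c (.seq (.push 4 true) (.push o true))).Exec (mem k) (mem 0)
      (k * (3 + 2) + 1) := by
    refine Prog.exec_drain mem k (fun i _ => ?_) (fun i hi => ?_)
    · simp [mem, hc, hoc.symm]
    · have := (Prog.Exec.push (σ := Function.update (mem (i + 1)) c (List.replicate i true))
        4 true).seq (Prog.Exec.push o true)
      convert this using 1
      have hi' : k - i = (k - (i + 1)) + 1 := by omega
      funext j
      simp only [mem, Function.update_apply, hi', List.replicate_succ]
      split_ifs <;> simp_all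
  have h0 : mem k = σ := by
    funext j; simp only [mem, Function.update_apply]; split_ifs <;> simp_all
  rw [h0] at h1
  have h2 := Prog.exec_move hc.symm (mem 0)
  have h3 := h1.seq (h2.seq (Prog.exec_pushList o (List.replicate r true ++ [false]) _))
  have hlen : (mem 0 4).length = k := by simp [mem, ho.symm]
  rw [hlen] at h3
  refine Prog.Exec.mono ?_ (show k * (3 + 2) + 1 + (3 * k + 1 +
    (2 * (List.replicate r true ++ [false]).length + 1) + 1) + 1 ≤ _ by simp; omega)
  rw [Prog.emitNat]
  convert h3 using 1
  funext j
  simp only [mem, Function.update_apply, unary, ← List.replicate_append_replicate]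
  split_ifs <;> simp_all
  rw [Nat.add_comm, List.replicate_add, List.append_assoc]

/-- Read a self-delimiting unary number from stack `0` and push it in unary on stack `c`; stack `6`
is used as a flag. -/
def Prog.parseUnary (c : ℕ) : Prog :=
  .seq (.push 6 true) (.loop 6 (.pop 6 .skip .skip
    (.pop 0 .skip .skip (.seq (.push c true) (.push 6 true)))))

theorem Prog.exec_parseUnary {c k : ℕ} {rest : List Bool} {σ : ℕ → List Bool} (hc0 : c ≠ 0)
    (hc6 : c ≠ 6) (h0 : σ 0 = unary k ++ rest) (h6 : σ 6 = []) :
    (Prog.parseUnary c).Exec σ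
      (Function.update (Function.update σ 0 rest) c (List.replicate k true ++ σ c))
      (6 * k + 8) := by
  -- The flag on stack `6` is removed at the start of each round and set again only after a `true`,
  -- so the terminating `false` ends the loop.
  have key : ∀ (k : ℕ) (σ : ℕ → List Bool), σ 0 = unary k ++ rest → σ 6 = [true] →
      (Prog.loop 6 (.pop 6 .skip .skip
        (.pop 0 .skip .skip (.seq (.push c true) (.push 6 true))))).Exec σ
      (Function.update (Function.update (Function.update σ 0 rest) c
        (List.replicate k true ++ σ c)) 6 []) (6 * k + 5) := by
    intro k
    induction k with
    | zero =>
      intro σ h0 h6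
      have h0' : Function.update σ 6 [] 0 = false :: rest := by simp [h0, unary]
      have h1 := Prog.Exec.loop_cons (s := 6) (by simp [h6])
        (Prog.Exec.pop_true (p := .skip) (q := .skip) h6
          (Prog.Exec.pop_false (p := .skip) (r := .seq (.push c true) (.push 6 true)) h0'
            Prog.Exec.skip))
        (Prog.Exec.loop_nil (by simp))
      refine Prog.Exec.mono ?_ (show 1 + 1 + 1 + 1 + 1 ≤ _ by omega)
      convert h1 using 1
      funext j; simp only [Function.update_apply]; split_ifs <;> simp_all
    | succ k ih =>
      intro σ h0 h6
      have h0' : Function.update σ 6 [] 0 = true :: (unary k ++ rest) := by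
        simp [h0, unary, List.replicate_succ]
      have h2 := ih (Function.update (Function.update (Function.update
        (Function.update σ 6 []) 0 (unary k ++ rest)) c (true :: σ c)) 6 [true])
        (by simp [hc0.symm]) (by simp)
      have h1 := Prog.Exec.loop_cons (s := 6) (by simp [h6])
        (Prog.Exec.pop_true (p := .skip) (q := .skip) h6
          (Prog.Exec.pop_true (p := .skip) (q := .skip) h0'
            ((Prog.Exec.push c true).seq (Prog.Exec.push 6 true))))
        (by
          convert h2 using 1
          funext j; simp only [Function.update_apply]; split_ifs <;> simp_all)
      refine Prog.Exec.mono ?_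
        (show 1 + 1 + 1 + 1 + 1 + (6 * k + 5) + 1 ≤ _ by omega)
      convert h1 using 1
      have : List.replicate (k + 1) true = List.replicate k true ++ [true] :=
        List.replicate_succ'
      funext j; simp only [Function.update_apply]; split_ifs <;> simp_all
  have h1 := (Prog.Exec.push (σ := σ) 6 true).seq
    (key k (Function.update σ 6 (true :: σ 6)) (by simp [h0]) (by simp [h6]))
  refine Prog.Exec.mono ?_ (show 1 + (6 * k + 5) + 1 ≤ _ by omega)
  rw [Prog.parseUnary]
  convert h1 using 1
  funext j; simp only [Function.update_apply]; split_ifs <;> simp_all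

/-! ### Gates on arbitrary index types, and templates of circuits -/

/-- A gate with qubits named by elements of `α`. -/
inductive QGate (α : Type) : Type
  | H (i : α) : QGate α
  | S (i : α) : QGate α
  | CZ (i j : α) : QGate α
  | T (i : α) : QGate α

namespace QGate

variable {α β : Type}

/-- The code of the kind of a gate. -/
def op : QGate α → List Bool
  | .H _ => [false, false]
  | .S _ => [false, true]
  | .CZ _ _ => [true, false]
  | .T _ => [true, true]

/-- The qubits on which a gate acts. -/
def args : QGate α → List α
  | .H i => [i]
  | .S i => [i]
  | .CZ i j => [i, j]
  | .T i => [i]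

/-- Renaming of the qubits. -/
def map (f : α → β) : QGate α → QGate β
  | .H i => .H (f i)
  | .S i => .S (f i)
  | .CZ i j => .CZ (f i) (f j)
  | .T i => .T (f i)

@[simp] theorem op_map (f : α → β) (g : QGate α) : (g.map f).op = g.op := by cases g <;> rfl

@[simp] theorem args_map (f : α → β) (g : QGate α) : (g.map f).args = g.args.map f := by
  cases g <;> rfl

theorem length_op (g : QGate α) : g.op.length = 2 := by cases g <;> rfl

theorem length_args_le (g : QGate α) : g.args.length ≤ 2 := by cases g <;> simp [args]

/-- The description of a gate, preceded by a marker bit. -/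
def encode (g : QGate ℕ) : List Bool := true :: (g.op ++ g.args.flatMap unary)

/-- Phase `(-1)^{abc}` with seven `T` gates, up to a constant factor, after summation over the
eight ancillas `q 0, …, q 7`: the ancillas `q 0, q 2, q 4, q 6` are forced to be the parities
`a ⊕ b`, `a ⊕ c`, `b ⊕ c` and `a ⊕ b ⊕ c`. -/
def ccz (a b c : α) (q : ℕ → α) : List (QGate α) :=
  [T a, T b, T c] ++
  ([CZ (q 1) (q 0), CZ (q 1) a, CZ (q 1) b, S (q 0), S (q 0), S (q 0), T (q 0)] ++
  ([CZ (q 3) (q 2), CZ (q 3) a, CZ (q 3) c, S (q 2), S (q 2), S (q 2), T (q 2)] ++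
  ([CZ (q 5) (q 4), CZ (q 5) b, CZ (q 5) c, S (q 4), S (q 4), S (q 4), T (q 4)] ++
  [CZ (q 7) (q 6), CZ (q 7) a, CZ (q 7) b, CZ (q 7) c, T (q 6)])))

/-- Gates on the qubits `s = q 0`, `u = q 1`, `v = q 2` with phase `(-1)^{s + uv(1 - s)}`. -/
def weightGates (q : ℕ → α) : List (QGate α) :=
  [S (q 0), S (q 0), CZ (q 1) (q 2)] ++ ccz (q 0) (q 1) (q 2) fun r => q (3 + r)

/-- The sign correction for a literal that is not negated. -/
def signGates (neg : Bool) (z : α) : List (QGate α) := if neg then [] else [S z, S z]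

/-- Force the ancilla `u` to be the value of the qubit `x`, up to the sign correction. -/
def linkGates (x u z : α) : List (QGate α) := [CZ z u, CZ z x]

/-- Given ancillas `q 0`, `q 2`, `q 4`, factor `0` if they and the qubit `s` are all `1`, and a
constant factor otherwise. -/
def coreGates (s : α) (q : ℕ → α) : List (QGate α) :=
  [CZ (q 7) (q 6), CZ (q 9) (q 8)] ++ (ccz (q 7) (q 0) (q 2) (fun r => q (11 + r)) ++
    (ccz (q 9) (q 4) s (fun r => q (19 + r)) ++ ccz (q 10) (q 6) (q 8) fun r => q (27 + r)))

end QGate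

open QGate

/-- The gates of a literal, the `i`-th one of a clause, for a block of ancillas starting at `B`. -/
def litGates {n : ℕ} (B i : ℕ) (l : Literal n) : List (QGate ℕ) :=
  signGates l.neg (B + (2 * i + 1)) ++ linkGates (11 + (l.var : ℕ)) (B + 2 * i) (B + (2 * i + 1))

/-- The gates of a clause, for the block of `35` ancillas starting at `B`. -/
def clauseGates {n : ℕ} (B : ℕ) (c : Literal n × Literal n × Literal n) : List (QGate ℕ) :=
  litGates B 0 c.1 ++ (litGates B 1 c.2.1 ++ (litGates B 2 c.2.2 ++ coreGates 0 fun r => B + r))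

/-- The gates of a list of clauses, with consecutive blocks of ancillas. -/
def clausesGates {n : ℕ} : ℕ → List (Literal n × Literal n × Literal n) → List (QGate ℕ)
  | _, [] => []
  | B, c :: cs => clauseGates B c ++ clausesGates (B + 35) cs

/-- Hadamard gates on the first `k` qubits. -/
def hadamards : ℕ → List (QGate ℕ)
  | 0 => []
  | k + 1 => .H k :: hadamards k

/-- The number of qubits of the circuit of `f`. -/
def CNF3.qubits (f : CNF3) : ℕ := 11 + f.n + 35 * f.m

/-- The diagonal part of the circuit of `f`. -/
def CNF3.diagGates (f : CNF3) : List (QGate ℕ) :=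
  weightGates id ++ clausesGates (11 + f.n) f.clauses

/-- The gates of the circuit of `f`. -/
def CNF3.circuitGates (f : CNF3) : List (QGate ℕ) :=
  hadamards f.qubits ++ (f.diagGates ++ hadamards f.qubits)

/-- The description of the circuit of `f`. -/
def CNF3.circuitCode (f : CNF3) : List Bool :=
  unary f.qubits ++ f.circuitGates.flatMap QGate.encode ++ [false]

/-! ### Emitting gates -/

/-- Names of qubits relative to the registers of the translating program. -/
inductive Ref : Type
  | anc (r : ℕ) : Ref
  | var : Ref
  | glob (r : ℕ) : Ref

namespace Ref

/-- The stack holding the variable part of the index. -/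
def stack : Ref → ℕ
  | anc _ => 3
  | var => 5
  | glob _ => 7

/-- The constant part of the index. -/
def offset : Ref → ℕ
  | anc r => r
  | var => 11
  | glob r => r

/-- The value of the register. -/
def base (B v : ℕ) : Ref → ℕ
  | anc _ => B
  | var => v
  | glob _ => 0

/-- The index of the qubit. -/
def val (B v : ℕ) : Ref → ℕ
  | anc r => B + r
  | var => 11 + v
  | glob r => r

theorem base_add_offset (B v : ℕ) (r : Ref) : r.base B v + r.offset = r.val B v := by
  cases r <;> simp [base, offset, val, add_comm]

end Ref

/-- The memory layout of the translating program. -/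
def layout (x o₁ o₂ : List Bool) (B v e : ℕ) : ℕ → List Bool
  | 0 => x
  | 1 => o₁
  | 2 => o₂
  | 3 => List.replicate B true
  | 5 => List.replicate v true
  | 6 => List.replicate e true
  | _ => []

section layout

variable (x o₁ o₂ y : List Bool) (B v e k : ℕ)

@[simp] theorem update_layout_zero :
    Function.update (layout x o₁ o₂ B v e) 0 y = layout y o₁ o₂ B v e := by
  funext j; simp only [Function.update_apply]; unfold layout; split_ifs <;> split <;> simp_all

@[simp] theorem update_layout_one :
    Function.update (layout x o₁ o₂ B v e) 1 y = layout x y o₂ B v e := by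
  funext j; simp only [Function.update_apply]; unfold layout; split_ifs <;> split <;> simp_all

@[simp] theorem update_layout_two :
    Function.update (layout x o₁ o₂ B v e) 2 y = layout x o₁ y B v e := by
  funext j; simp only [Function.update_apply]; unfold layout; split_ifs <;> split <;> simp_all

@[simp] theorem update_layout_three :
    Function.update (layout x o₁ o₂ B v e) 3 (List.replicate k true) = layout x o₁ o₂ k v e := by
  funext j; simp only [Function.update_apply]; unfold layout; split_ifs <;> split <;> simp_all

@[simp] theorem update_layout_five :
    Function.update (layout x o₁ o₂ B v e) 5 (List.replicate k true) = layout x o₁ o₂ B k e := by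
  funext j; simp only [Function.update_apply]; unfold layout; split_ifs <;> split <;> simp_all

@[simp] theorem update_layout_six :
    Function.update (layout x o₁ o₂ B v e) 6 (List.replicate k true) = layout x o₁ o₂ B v k := by
  funext j; simp only [Function.update_apply]; unfold layout; split_ifs <;> split <;> simp_all

@[simp] theorem layout_zero : layout x o₁ o₂ B v e 0 = x := rfl
@[simp] theorem layout_one : layout x o₁ o₂ B v e 1 = o₁ := rfl
@[simp] theorem layout_two : layout x o₁ o₂ B v e 2 = o₂ := rfl
@[simp] theorem layout_three : layout x o₁ o₂ B v e 3 = List.replicate B true := rfl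
@[simp] theorem layout_five : layout x o₁ o₂ B v e 5 = List.replicate v true := rfl
@[simp] theorem layout_six : layout x o₁ o₂ B v e 6 = List.replicate e true := rfl

/-- Stack `7` is always empty: it is the register with value `0`, which lets absolute indices be
emitted by the same routine. -/
theorem layout_stack (r : Ref) :
    layout x o₁ o₂ B v e r.stack = List.replicate (r.base B v) true := by
  cases r <;> rfl

end layout

namespace Prog

/-- Write the indices of some qubits on stack `o`. -/
def emitRefs (o : ℕ) : List Ref → Prog
  | [] => .skip
  | r :: l => .seq (.emitNat o r.stack r.offset) (emitRefs o l)

/-- Write the descriptions of some gates on stack `o`. -/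
def emitGates (o : ℕ) : List (QGate Ref) → Prog
  | [] => .skip
  | g :: l => .seq (.seq (.pushList o (true :: g.op)) (.emitRefs o g.args)) (emitGates o l)

variable {x o₁ o₂ : List Bool} {B v e N : ℕ}

theorem exec_emitRefs {o : ℕ} (ho : o = 1 ∨ o = 2) (l : List Ref)
    (hl : ∀ r ∈ l, r.val B v ≤ N) :
    (emitRefs o l).Exec (layout x o₁ o₂ B v e) (Function.update (layout x o₁ o₂ B v e) o
      (((l.map (Ref.val B v)).flatMap unary).reverse ++ layout x o₁ o₂ B v e o))
      (l.length * (8 * N + 8) + 1) := by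
  induction l generalizing o₁ o₂ with
  | nil => simpa [emitRefs] using Exec.skip
  | cons r l ih =>
    have h1 := exec_emitNat (o := o) (c := r.stack) (r := r.offset) (k := r.base B v)
      (σ := layout x o₁ o₂ B v e) (by omega) (by cases r <;> simp [Ref.stack])
      (by cases r <;> simp [Ref.stack] <;> omega) rfl (layout_stack ..)
    rw [Ref.base_add_offset] at h1
    have h0 := hl r (by simp)
    have hl' : ∀ r ∈ l, r.val B v ≤ N := fun r hr => hl r (by simp [hr])
    rw [emitRefs]
    rcases ho with rfl | rfl
    · simp only [update_layout_one, layout_one] at h1 ih ⊢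
      have h := (h1.seq (ih hl')).mono (b := (r :: l).length * (8 * N + 8) + 1)
        (by simp only [List.length_cons]; linarith [Nat.succ_mul l.length (8 * N + 8)])
      convert h using 2
      simp
    · simp only [update_layout_two, layout_two] at h1 ih ⊢
      have h := (h1.seq (ih hl')).mono (b := (r :: l).length * (8 * N + 8) + 1)
        (by simp only [List.length_cons]; linarith [Nat.succ_mul l.length (8 * N + 8)])
      convert h using 2
      simp

theorem exec_emitGates {o : ℕ} (ho : o = 1 ∨ o = 2) (l : List (QGate Ref))
    (hl : ∀ g ∈ l, ∀ r ∈ g.args, r.val B v ≤ N) :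
    (emitGates o l).Exec (layout x o₁ o₂ B v e) (Function.update (layout x o₁ o₂ B v e) o
      (((l.map (QGate.map (Ref.val B v))).flatMap QGate.encode).reverse ++
        layout x o₁ o₂ B v e o)) (l.length * (16 * N + 26) + 1) := by
  induction l generalizing o₁ o₂ with
  | nil => simpa [emitGates] using Exec.skip
  | cons g l ih =>
    have h1 := exec_pushList o (true :: g.op) (layout x o₁ o₂ B v e)
    have h2 := fun a b => exec_emitRefs (x := x) (o₁ := a) (o₂ := b) (e := e) ho g.args
      (hl g (by simp))
    have hl' : ∀ g ∈ l, ∀ r ∈ g.args, r.val B v ≤ N := fun r hr => hl r (by simp [hr])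
    have hop := g.length_op
    have harg := Nat.mul_le_mul_right (8 * N + 8) g.length_args_le
    rw [emitGates]
    rcases ho with rfl | rfl
    · simp only [update_layout_one, layout_one] at h1 h2 ih ⊢
      have h := ((h1.seq (h2 _ _)).seq (ih hl')).mono (b := (g :: l).length * (16 * N + 26) + 1)
        (by simp only [List.length_cons, hop]; linarith [Nat.succ_mul l.length (16 * N + 26)])
      convert h using 2
      simp [QGate.encode]
    · simp only [update_layout_two, layout_two] at h1 h2 ih ⊢
      have h := ((h1.seq (h2 _ _)).seq (ih hl')).mono (b := (g :: l).length * (16 * N + 26) + 1)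
        (by simp only [List.length_cons, hop]; linarith [Nat.succ_mul l.length (16 * N + 26)])
      convert h using 2
      simp [QGate.encode]

end Prog

namespace Prog

variable {x o₁ o₂ : List Bool} {B v e N n : ℕ}

theorem exec_emitGates_one (l : List (QGate Ref)) (hl : ∀ g ∈ l, ∀ r ∈ g.args, r.val B v ≤ N) :
    (emitGates 1 l).Exec (layout x o₁ o₂ B v e)
      (layout x (((l.map (QGate.map (Ref.val B v))).flatMap QGate.encode).reverse ++ o₁) o₂ B v e)
      (l.length * (16 * N + 26) + 1) := by
  simpa using exec_emitGates (x := x) (o₁ := o₁) (o₂ := o₂) (e := e) (Or.inl rfl) l hl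

/-- Remove all bits of stack `5`. -/
theorem exec_clear : (drain 5 .skip).Exec (layout x o₁ o₂ B v e) (layout x o₁ o₂ B 0 e)
    (v * 3 + 1) :=
  exec_drain (c := 1) (fun i => layout x o₁ o₂ B i e) v (fun _ _ => rfl) fun i _ => by
    simpa using Exec.skip

/-! ### The program that writes the description of the circuit of a 3-CNF -/

/-- Read the `i`-th literal of a clause and write its gates. -/
def transformLit (i : ℕ) : Prog :=
  .seq (.pop 0 .skip (emitGates 1 (signGates false (.anc (2 * i + 1)))) .skip)
    (.seq (parseUnary 5)
      (.seq (emitGates 1 (linkGates .var (.anc (2 * i)) (.anc (2 * i + 1)))) (drain 5 .skip)))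

theorem exec_transformLit {i : ℕ} (hi : i ≤ 2) (hB : B + 35 ≤ N) (hn : 11 + n ≤ N)
    (l : Literal n) :
    (transformLit i).Exec (layout (l.encode ++ x) o₁ o₂ B 0 0)
      (layout x (((litGates B i l).flatMap QGate.encode).reverse ++ o₁) o₂ B 0 0)
      (80 * N + 130) := by
  have hv := l.var.isLt
  have h1 : (Prog.pop 0 .skip (emitGates 1 (signGates false (.anc (2 * i + 1)))) .skip).Exec
      (layout (l.encode ++ x) o₁ o₂ B 0 0) (layout (unary l.var ++ x)
        (((signGates l.neg (B + (2 * i + 1))).flatMap QGate.encode).reverse ++ o₁) o₂ B 0 0)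
      (32 * N + 54) := by
    cases hneg : l.neg
    · have h := exec_emitGates_one (x := unary l.var ++ x) (o₁ := o₁) (o₂ := o₂) (B := B) (v := 0)
        (e := 0) (N := N) (signGates false (.anc (2 * i + 1)))
        (by simp [signGates, args, Ref.val]; omega)
      rw [← update_layout_zero (l.encode ++ x)] at h
      exact (Exec.pop_false (by simp [Literal.encode, hneg]) h).mono (by simp [signGates]; omega)
    · have h := Exec.skip (σ := layout (unary l.var ++ x) o₁ o₂ B 0 0)
      rw [← update_layout_zero (l.encode ++ x)] at h
      refine Exec.mono ?_ (show 1 + 1 ≤ _ by omega)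
      simpa [signGates] using Exec.pop_true (p := .skip)
        (q := emitGates 1 (signGates false (.anc (2 * i + 1))))
        (l := unary l.var ++ x) (by simp [Literal.encode, hneg]) h
  have h2 := fun a => exec_parseUnary (c := 5) (k := l.var) (rest := x)
    (σ := layout (unary l.var ++ x) a o₂ B 0 0) (by simp) (by simp) (by simp) (by simp)
  have h3 := fun a => exec_emitGates_one (x := x) (o₁ := a) (o₂ := o₂) (B := B) (v := l.var)
    (e := 0) (N := N) (linkGates .var (.anc (2 * i)) (.anc (2 * i + 1)))
    (by simp [linkGates, args, Ref.val]; omega)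
  simp only [update_layout_zero, layout_five, List.replicate_zero, List.append_nil,
    update_layout_five] at h2
  have h := (h1.seq ((h2 _).seq ((h3 _).seq exec_clear))).mono (b := 80 * N + 130)
    (by simp [linkGates]; omega)
  rw [transformLit]
  convert h using 2
  simp [litGates, linkGates, QGate.map, Ref.val]

/-- Read a marker bit and, if it is `true`, a clause; write the gates of the clause. -/
def transformClause : Prog :=
  .pop 6 .skip .skip (.pop 0 .skip .skip
    (.seq (transformLit 0) (.seq (transformLit 1) (.seq (transformLit 2)
      (.seq (emitGates 1 (coreGates (.glob 0) .anc))
        (.seq (pushList 3 (List.replicate 35 true)) (.push 6 true)))))))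

/-- The part of the description of a 3-CNF that lists the clauses. -/
def _root_.FineGrained.encodeClauses (cs : List (Literal n × Literal n × Literal n)) : List Bool :=
  cs.flatMap (fun c => true :: (c.1.encode ++ c.2.1.encode ++ c.2.2.encode)) ++ [false]

theorem exec_transformClause (hB : B + 35 ≤ N) (hn : 11 + n ≤ N)
    (c : Literal n × Literal n × Literal n) :
    transformClause.Exec
      (layout (true :: (c.1.encode ++ c.2.1.encode ++ c.2.2.encode) ++ x) o₁ o₂ B 0 1)
      (layout x (((clauseGates B c).flatMap QGate.encode).reverse ++ o₁) o₂ (B + 35) 0 1)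
      (1700 * N + 2900) := by
  have h1 := fun y a => exec_transformLit (x := y) (o₁ := a) (o₂ := o₂) (i := 0) (by omega) hB hn
    c.1
  have h2 := fun y a => exec_transformLit (x := y) (o₁ := a) (o₂ := o₂) (i := 1) (by omega) hB hn
    c.2.1
  have h3 := fun y a => exec_transformLit (x := y) (o₁ := a) (o₂ := o₂) (i := 2) (by omega) hB hn
    c.2.2
  have h4 := fun a => exec_emitGates_one (x := x) (o₁ := a) (o₂ := o₂) (B := B) (v := 0)
    (e := 0) (N := N) (coreGates (.glob 0) .anc)
    (by simp [coreGates, ccz, args, Ref.val]; omega)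
  have h5 := fun a => exec_pushList 3 (List.replicate 35 true) (layout x a o₂ B 0 0)
  have h6 := fun a => Exec.push (σ := layout x a o₂ (35 + B) 0 0) 6 true
  rw [List.reverse_replicate] at h5
  simp only [layout_three, List.replicate_append_replicate, update_layout_three] at h5
  have e6 : true :: List.replicate 0 true = List.replicate 1 true := rfl
  simp only [layout_six, e6, update_layout_six] at h6
  have h := (h1 _ o₁).seq ((h2 _ _).seq ((h3 _ _).seq ((h4 _).seq ((h5 _).seq (h6 _)))))
  rw [← update_layout_zero (true :: (c.1.encode ++ c.2.1.encode ++ c.2.2.encode) ++ x)] at h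
  have h' := Exec.pop_true (p := .skip) (q := .skip) (by simp) h
  have e0 : layout (true :: (c.1.encode ++ c.2.1.encode ++ c.2.2.encode) ++ x) o₁ o₂ B 0 0 =
    Function.update (layout (true :: (c.1.encode ++ c.2.1.encode ++ c.2.2.encode) ++ x)
      o₁ o₂ B 0 1) 6 (List.replicate 0 true) := (update_layout_six ..).symm
  rw [e0] at h'
  -- Most of this bound comes from the `89` core gates, at `16 * N + 26` steps each.
  have h'' := (Exec.pop_true (p := .skip) (q := .skip) (by rfl) h').mono
    (b := 1700 * N + 2900) (by simp [coreGates, ccz]; omega)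
  rw [transformClause]
  convert h'' using 2
  · simp [clauseGates, coreGates, ccz, QGate.map, Ref.val]
  · omega

/-- Stack `3` starts as the base of the first block and grows by `35` per clause, so at the end it
holds the first unused index. In `exec_transform` this is the number of qubits, as needed for the
Hadamard layers. -/
theorem exec_transformClauses (cs : List (Literal n × Literal n × Literal n))
    (hB : B + 35 * cs.length ≤ N) (hn : 11 + n ≤ N) :
    (Prog.loop 6 transformClause).Exec (layout (encodeClauses cs) o₁ o₂ B 0 1)
      (layout [] (((clausesGates B cs).flatMap QGate.encode).reverse ++ o₁) o₂
        (B + 35 * cs.length) 0 0)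
      (cs.length * (1700 * N + 2901) + 5) := by
  induction cs generalizing B o₁ with
  | nil =>
    have h1 : Exec .skip (Function.update (Function.update (layout [false] o₁ o₂ B 0 1) 6
        (List.replicate 0 true)) 0 []) (layout [] o₁ o₂ B 0 0) 1 := by
      rw [update_layout_six, update_layout_zero]
      exact Exec.skip
    have h2 := Exec.pop_true (s := 6) (p := .skip) (q := .skip) (by rfl)
      (Exec.pop_false (s := 0) (p := .skip) (r := (.seq (transformLit 0) (.seq (transformLit 1)
        (.seq (transformLit 2) (.seq (emitGates 1 (coreGates (.glob 0) .anc))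
        (.seq (pushList 3 (List.replicate 35 true)) (.push 6 true))))))) (by simp) h1)
    exact (Exec.loop_cons (s := 6) (by simp) h2 (Exec.loop_nil (by simp))).mono (by simp)
  | cons c cs ih =>
    simp only [List.length_cons] at hB
    have h1 := exec_transformClause (x := encodeClauses cs) (o₁ := o₁) (o₂ := o₂) (B := B)
      (by omega) hn c
    have h2 := ih (B := B + 35)
      (o₁ := ((clauseGates B c).flatMap QGate.encode).reverse ++ o₁) (by omega)
    have h := (Exec.loop_cons (s := 6) (by simp) h1 h2).mono
      (b := (c :: cs).length * (1700 * N + 2901) + 5)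
      (by simp only [List.length_cons]; linarith [Nat.succ_mul cs.length (1700 * N + 2901)])
    convert h using 2
    · simp [encodeClauses]
    · simp [clausesGates]
    · simp; omega

/-- Write the description of a layer of Hadamard gates on stack `o`. -/
def emitHadamards (o : ℕ) : Prog :=
  .seq (.drain 3 (.seq (emitGates o [QGate.H (.anc 0)]) (.push 5 true))) (.move 5 3)

theorem exec_emitHadamards {o : ℕ} (ho : o = 1 ∨ o = 2) :
    (emitHadamards o).Exec (layout x o₁ o₂ N 0 0)
      (Function.update (layout x o₁ o₂ N 0 0) o
        (((hadamards N).flatMap QGate.encode).reverse ++ layout x o₁ o₂ N 0 0 o))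
      (N * (16 * N + 34) + 3) := by
  -- The remaining counter on stack `3` is itself the index of the next Hadamard. Spent bits
  -- accumulate on stack `5`, which allows the counter to be restored.
  have key : ∀ (k v : ℕ) (o₁ o₂ : List Bool), k ≤ N →
      (drain 3 (.seq (emitGates o [QGate.H (.anc 0)]) (.push 5 true))).Exec
      (layout x o₁ o₂ k v 0) (Function.update (layout x o₁ o₂ 0 (k + v) 0) o
        (((hadamards k).flatMap QGate.encode).reverse ++ layout x o₁ o₂ 0 (k + v) 0 o))
      (k * (16 * N + 31) + 1) := by
    intro k
    induction k with
    | zero =>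
      intro v o₁ o₂ _
      simpa [hadamards, drain] using Exec.loop_nil (s := 3)
        (p := .pop 3 .skip (.seq (emitGates o [QGate.H (.anc 0)]) (.push 5 true))
          (.seq (emitGates o [QGate.H (.anc 0)]) (.push 5 true))) (σ := layout x o₁ o₂ 0 v 0) (by simp)
    | succ k ih =>
      intro v o₁ o₂ hk
      have h1 := exec_emitGates (x := x) (o₁ := o₁) (o₂ := o₂) (B := k) (v := v) (e := 0)
        (N := N) ho [QGate.H (.anc 0)] (by simp [args, Ref.val]; omega)
      have h2 := fun a b => Exec.push (σ := layout x a b k v 0) 5 true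
      have h3 := fun a b => ih (v + 1) a b (by omega)
      simp only [layout_five, ← List.replicate_succ, update_layout_five] at h2
      have e0 : layout x o₁ o₂ k v 0 = Function.update (layout x o₁ o₂ (k + 1) v 0) 3
        (List.replicate k true) := (update_layout_three ..).symm
      rw [drain]
      rcases ho with rfl | rfl
      · simp only [update_layout_one, layout_one] at h1 h3 ⊢
        have h4 := h1.seq (h2 _ _)
        rw [e0] at h4
        have h5 := Exec.pop_true (p := .skip) (q := .seq (emitGates 1 [QGate.H (.anc 0)])
          (.push 5 true)) (by rfl) h4
        have h := (Exec.loop_cons (s := 3) (by simp) h5 (h3 _ _)).mono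
          (b := (k + 1) * (16 * N + 31) + 1)
          (by simp only [List.length_singleton]; linarith [Nat.succ_mul k (16 * N + 31)])
        convert h using 2
        · simp [hadamards, QGate.map, Ref.val]
        · omega
      · simp only [update_layout_two, layout_two] at h1 h3 ⊢
        have h4 := h1.seq (h2 _ _)
        rw [e0] at h4
        have h5 := Exec.pop_true (p := .skip) (q := .seq (emitGates 2 [QGate.H (.anc 0)])
          (.push 5 true)) (by rfl) h4
        have h := (Exec.loop_cons (s := 3) (by simp) h5 (h3 _ _)).mono
          (b := (k + 1) * (16 * N + 31) + 1)
          (by simp only [List.length_singleton]; linarith [Nat.succ_mul k (16 * N + 31)])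
        convert h using 2
        · simp [hadamards, QGate.map, Ref.val]
        · omega
  have h1 := key N 0 o₁ o₂ le_rfl
  have h2 := fun a b => exec_move (s := 5) (t := 3) (by simp) (layout x a b 0 N 0)
  have e0 : ∀ a b, Function.update (layout x a b 0 N 0) 5 [] = layout x a b 0 0 0 :=
    fun a b => update_layout_five (k := 0) ..
  simp only [layout_five, layout_three, List.reverse_replicate, List.replicate_append_replicate,
    e0, update_layout_three, List.length_replicate, add_zero] at h1 h2
  rw [emitHadamards]
  rcases ho with rfl | rfl
  · simp only [update_layout_one, layout_one] at h1 ⊢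
    exact (h1.seq (h2 _ _)).mono (by ring_nf; omega)
  · simp only [update_layout_two, layout_two] at h1 ⊢
    exact (h1.seq (h2 _ _)).mono (by ring_nf; omega)

/-- Replace the description of a 3-CNF on stack `0` by the description of its circuit. -/
def transform : Prog :=
  .seq (.seq (pushList 3 (List.replicate 11 true)) (.seq (parseUnary 3)
    (.seq (emitGates 1 (weightGates .glob)) (.seq (.push 6 true) (.seq (.loop 6 transformClause)
      (.seq (emitHadamards 1) (.seq (emitHadamards 2) (.push 1 false))))))))
    (.seq (.move 1 0) (.seq (.move 2 0) (.seq (.push 0 false) (.move 3 0))))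

/-- The number of qubits is known only once all clauses are read, although it and the first Hadamard
layer open the description. That layer is therefore kept apart on stack `2`. All output is stored
reversed, and the final moves onto stack `0`, from the last piece to the first, put it in order. -/
theorem exec_transform (f : CNF3) :
    transform.Exec (layout f.encode [] [] 0 0 0) (layout f.circuitCode [] [] 0 0 0)
      (100000 * (f.qubits + 1) ^ 2) := by
  obtain ⟨N, hN⟩ : ∃ N, N = f.qubits := ⟨_, rfl⟩
  have hNq := hN
  rw [CNF3.qubits, CNF3.m] at hNq
  have h1 := exec_pushList 3 (List.replicate 11 true) (layout f.encode [] [] 0 0 0)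
  rw [List.reverse_replicate] at h1
  simp only [layout_three, List.replicate_append_replicate, update_layout_three] at h1
  have h2 := exec_parseUnary (c := 3) (k := f.n) (rest := encodeClauses f.clauses)
    (σ := layout f.encode [] [] 11 0 0) (by simp) (by simp)
    (by simp [CNF3.encode, encodeClauses]) (by simp)
  simp only [update_layout_zero, layout_three, List.replicate_append_replicate,
    update_layout_three] at h2
  have h3 := exec_emitGates_one (x := encodeClauses f.clauses) (o₁ := []) (o₂ := [])
    (B := f.n + 11) (v := 0) (e := 0) (N := N) (weightGates .glob)
    (by simp [weightGates, ccz, args, Ref.val]; omega)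
  have h4 := fun a => Exec.push (σ := layout (encodeClauses f.clauses) a [] (f.n + 11) 0 0) 6 true
  have e6 : true :: List.replicate 0 true = List.replicate 1 true := rfl
  simp only [layout_six, e6, update_layout_six] at h4
  have h5 := fun a => exec_transformClauses (o₁ := a) (o₂ := []) (B := f.n + 11) (N := N)
    f.clauses (by omega) (by omega)
  have e7 : f.n + 11 + 35 * f.clauses.length = N := by omega
  rw [e7] at h5
  have h6 := fun a => exec_emitHadamards (x := []) (o₁ := a) (o₂ := []) (N := N) (Or.inl rfl)
  have h7 := fun a => exec_emitHadamards (x := []) (o₁ := a) (o₂ := []) (N := N) (Or.inr rfl)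
  simp only [update_layout_one, layout_one, update_layout_two, layout_two] at h6 h7
  have h8 := fun a b => Exec.push (σ := layout [] a b N 0 0) 1 false
  simp only [update_layout_one, layout_one] at h8
  have hA := h1.seq (h2.seq (h3.seq ((h4 _).seq ((h5 _).seq ((h6 _).seq ((h7 _).seq
    (h8 _ _)))))))
  -- The output lengths, which determine the cost of the final moves, are bounded by the time
  -- already spent.
  have hlen1 := hA.length_le 1
  have hlen2 := hA.length_le 2
  rw [layout_one, layout_one] at hlen1
  rw [layout_two, layout_two] at hlen2
  have h9 := fun a b => exec_move (s := 1) (t := 0) (by simp) (layout [] a b N 0 0)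
  have h10 := fun a b => exec_move (s := 2) (t := 0) (by simp) (layout a [] b N 0 0)
  have h11 := fun a => Exec.push (σ := layout a [] [] N 0 0) 0 false
  have h12 := fun a => exec_move (s := 3) (t := 0) (by simp) (layout a [] [] N 0 0)
  have e3 : ∀ a, Function.update (layout a [] [] N 0 0) 3 [] = layout a [] [] 0 0 0 :=
    fun a => update_layout_three (k := 0) ..
  simp only [update_layout_one, layout_one, update_layout_zero, layout_zero, update_layout_two,
    layout_two, layout_three, e3, List.length_replicate] at h9 h10 h11 h12
  have hm : f.clauses.length * (1700 * N + 2901) ≤ N * (1700 * N + 2901) :=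
    Nat.mul_le_mul_right _ (by omega)
  have hnN : f.n ≤ N := by omega
  have hw : (weightGates Ref.glob).length = 32 := by simp [weightGates, ccz]
  rw [hw] at hA hlen1 hlen2
  simp only [List.length_replicate, List.length_nil] at hA hlen1 hlen2
  have h := (hA.seq ((h9 _ _).seq ((h10 _ _).seq ((h11 _).seq (h12 _))))).mono
    (b := 100000 * (N + 1) ^ 2) (by nlinarith)
  rw [transform, ← hN]
  convert h using 2
  simp [CNF3.circuitCode, ← hN, CNF3.circuitGates, CNF3.diagGates, weightGates, ccz, QGate.map,
    Ref.val, unary, add_comm f.n 11]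

end Prog

/-! ### Sums over assignments of consecutive bits -/

/-- The sum of `F` over all values of the bits `a, …, a + k - 1`, the others being those of `y`. -/
noncomputable def bsum : ℕ → ℕ → ((ℕ → Bool) → ℂ) → (ℕ → Bool) → ℂ
  | _, 0, F, y => F y
  | a, k + 1, F, y => ∑ b : Bool, bsum (a + 1) k F (Function.update y a b)

theorem bsum_add (a k l : ℕ) (F : (ℕ → Bool) → ℂ) (y : ℕ → Bool) :
    bsum a (k + l) F y = bsum a k (bsum (a + k) l F) y := by
  induction k generalizing a y with
  | zero => simp [bsum]
  | succ k ih =>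
    rw [show k + 1 + l = k + l + 1 by omega]
    simp only [bsum, ih]
    rw [show a + 1 + k = a + (k + 1) by omega]

/-- If `F` and `G` agree on all assignments with the bits of `y` outside of `a, …, a + k - 1`. -/
theorem bsum_congr {a k : ℕ} {F G : (ℕ → Bool) → ℂ} {y : ℕ → Bool}
    (h : ∀ z : ℕ → Bool, (∀ i, i < a ∨ a + k ≤ i → z i = y i) → F z = G z) :
    bsum a k F y = bsum a k G y := by
  induction k generalizing a y with
  | zero => exact h y fun _ _ => rfl
  | succ k ih =>
    refine Finset.sum_congr rfl fun b _ => ih fun z hz => h z fun i hi => ?_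
    rw [hz i (by omega), Function.update_of_ne (by omega)]

theorem bsum_const_mul (a k : ℕ) (c : ℂ) (F : (ℕ → Bool) → ℂ) (y : ℕ → Bool) :
    bsum a k (fun z => c * F z) y = c * bsum a k F y := by
  induction k generalizing a y with
  | zero => rfl
  | succ k ih => simp only [bsum, ih, Finset.mul_sum]

/-- `F` depends only on the bits below `B`. -/
def LocalBelow (B : ℕ) (F : (ℕ → Bool) → ℂ) : Prop :=
  ∀ y z : ℕ → Bool, (∀ i < B, y i = z i) → F y = F z

/-- A sum over two blocks of bits, where the factor `G` does not couple to the first block. -/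
theorem bsum_mul {B k l : ℕ} {F G H : (ℕ → Bool) → ℂ} (hF : LocalBelow (B + k) F)
    (hH : LocalBelow B H) (hG : ∀ y, bsum (B + k) l G y = H y) (y : ℕ → Bool) :
    bsum B (k + l) (fun z => F z * G z) y = bsum B k F y * H y := by
  have h1 : ∀ z, bsum (B + k) l (fun z => F z * G z) z = F z * H z := fun z => by
    rw [← hG z, ← bsum_const_mul]
    exact bsum_congr fun w hw => by rw [hF w z fun i hi => hw i (Or.inl hi)]
  rw [bsum_add, mul_comm, ← bsum_const_mul]
  refine bsum_congr fun z hz => ?_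
  rw [h1, mul_comm, hH z y fun i hi => hz i (Or.inl hi)]

/-- The sign `(-1)^b`. -/
def sgn (b : Bool) : ℂ := if b then -1 else 1

/-- The sum over the bits of a block is the sum over all functions on the block. -/
theorem bsum_eq_sum (a n : ℕ) (F : (ℕ → Bool) → ℂ) (G : (Fin n → Bool) → ℂ)
    (h : ∀ z, F z = G fun i => z (a + i)) (y : ℕ → Bool) :
    bsum a n F y = ∑ x : Fin n → Bool, G x := by
  induction n generalizing a F y with
  | zero =>
    rw [Fintype.sum_unique]
    exact (h y).trans (congrArg G (Subsingleton.elim _ _))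
  | succ n ih =>
    rw [← (Fin.consEquiv fun _ => Bool).sum_comp, Fintype.sum_prod_type]
    refine Finset.sum_congr rfl fun b _ => ?_
    refine (bsum_congr (G := fun z => F (Function.update z a b)) fun z hz => ?_).trans
      (ih (a + 1) _ (fun x => G (Fin.cons b x)) (fun z => ?_) _)
    · rw [← Function.update_self (β := fun _ => Bool) a b y, ← hz a (by omega),
        Function.update_eq_self]
    · rw [h]
      congr 1
      funext i
      refine Fin.cases ?_ (fun j => ?_) i
      · simp
      · rw [Fin.cons_succ, Function.update_of_ne (by simp), Fin.val_succ]
        congr 1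
        omega

/-! ### Phases of diagonal gates -/

/-- The phase of the `T` gate. -/
noncomputable def tPhase : ℂ := Complex.exp (Complex.I * Real.pi / 4)

theorem tPhase_mul_self : tPhase * tPhase = Complex.I := by
  rw [tPhase, ← Complex.exp_add]
  refine (congrArg Complex.exp ?_).trans Complex.exp_pi_div_two_mul_I
  ring

/-- The phase of a diagonal gate on a basis state (the phase of `H` is not used). -/
noncomputable def QGate.phase : QGate ℕ → (ℕ → Bool) → ℂ
  | .H _, _ => 1
  | .S i, y => if y i then Complex.I else 1
  | .CZ i j, y => if y i && y j then -1 else 1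
  | .T i, y => if y i then tPhase else 1

/-- The phase of a list of diagonal gates. -/
noncomputable def phases (gs : List (QGate ℕ)) (y : ℕ → Bool) : ℂ :=
  (gs.map fun g => g.phase y).prod

@[simp] theorem phases_nil (y : ℕ → Bool) : phases [] y = 1 := rfl

@[simp] theorem phases_cons (g : QGate ℕ) (gs : List (QGate ℕ)) (y : ℕ → Bool) :
    phases (g :: gs) y = g.phase y * phases gs y := by simp [phases]

theorem phases_append (gs hs : List (QGate ℕ)) (y : ℕ → Bool) :
    phases (gs ++ hs) y = phases gs y * phases hs y := by simp [phases]

theorem localBelow_phases {B : ℕ} {gs : List (QGate ℕ)} (h : ∀ g ∈ gs, ∀ i ∈ g.args, i < B) :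
    LocalBelow B (phases gs) := by
  intro y z hyz
  refine congrArg List.prod (List.map_congr_left fun g hg => ?_)
  have := fun i hi => hyz i (h g hg i hi)
  cases g <;> simp_all [phase, args]

theorem LocalBelow.mul {B : ℕ} {F G : (ℕ → Bool) → ℂ} (hF : LocalBelow B F)
    (hG : LocalBelow B G) : LocalBelow B fun y => F y * G y :=
  fun y z h => by simp only [hF y z h, hG y z h]

theorem LocalBelow.mono {B C : ℕ} {F : (ℕ → Bool) → ℂ} (hF : LocalBelow B F) (h : B ≤ C) :
    LocalBelow C F :=
  fun y z hyz => hF y z fun i hi => hyz i (hi.trans_le h)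

/-- The phase of the inverse of the `T` gate, on a qubit holding `b`. -/
noncomputable def tInv (b : Bool) : ℂ := if b then -Complex.I * tPhase else 1

/-- Summing over the bit `B + 1` forces the bit `B` to be the parity of bits `p` and `q`, with a
factor `2`. The gates `S S S T` then apply the phase of `T⁻¹`, since `(-i) e^{iπ/4} = e^{-iπ/4}`. -/
theorem bsum_parity {p q B : ℕ} (hp : p < B) (hq : q < B) (y : ℕ → Bool) :
    bsum B 2 (phases [CZ (B + 1) B, CZ (B + 1) p, CZ (B + 1) q, S B, S B, S B, T B]) y =
      2 * tInv (xor (y p) (y q)) := by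
  have h1 : p ≠ B := by omega
  have h2 : q ≠ B := by omega
  have h3 : p ≠ B + 1 := by omega
  have h4 : q ≠ B + 1 := by omega
  cases hyp : y p <;> cases hyq : y q <;>
    simp [bsum, phase, Function.update_of_ne, h1, h2, h3, h4, hyp, hyq, tInv] <;>
    first | ring1 | linear_combination (2 * tPhase * Complex.I) * Complex.I_mul_I

theorem bsum_parity_three {p q r B : ℕ} (hp : p < B) (hq : q < B) (hr : r < B) (y : ℕ → Bool) :
    bsum B 2 (phases [CZ (B + 1) B, CZ (B + 1) p, CZ (B + 1) q, CZ (B + 1) r, T B]) y =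
      2 * if xor (xor (y p) (y q)) (y r) then tPhase else 1 := by
  have h1 : p ≠ B := by omega
  have h2 : q ≠ B := by omega
  have h3 : p ≠ B + 1 := by omega
  have h4 : q ≠ B + 1 := by omega
  have h5 : r ≠ B := by omega
  have h6 : r ≠ B + 1 := by omega
  cases hyp : y p <;> cases hyq : y q <;> cases hyr : y r <;>
    simp [bsum, phase, Function.update_of_ne, h1, h2, h3, h4, h5, h6, hyp, hyq, hyr] <;>
    ring

/-- For bits, `4abc = a + b + c - (a ⊕ b) - (a ⊕ c) - (b ⊕ c) + (a ⊕ b ⊕ c)`. Taking `e^{iπ/4}` to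
this power gives `(-1)^{abc}`. The four parity ancilla pairs contribute `2^4`; `bsum_mul` sums them
out from the last to the first, as each couples only to the bits `a`, `b`, `c` outside its own
block. -/
theorem bsum_ccz {a b c B : ℕ} (ha : a < B) (hb : b < B) (hc : c < B) (y : ℕ → Bool) :
    bsum B 8 (phases (ccz a b c fun r => B + r)) y = 16 * sgn (y a && y b && y c) := by
  have loc2 : ∀ {p q B : ℕ}, p < B → q < B → LocalBelow B fun y => 2 * tInv (xor (y p) (y q)) :=
    fun {p q B} hp hq y z h => by simp only [h p hp, h q hq]
  have h4 := bsum_parity_three (B := B + 6) (p := a) (q := b) (r := c) (by omega) (by omega)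
    (by omega)
  have loc4 : LocalBelow B fun y => 2 * if xor (xor (y a) (y b)) (y c) then tPhase else (1 : ℂ) :=
    fun y z h => by simp only [h a ha, h b hb, h c hc]
  have h3 := fun y => (bsum_mul (B := B + 4) (k := 2) (localBelow_phases (by
    simp [args]; omega)) (loc4.mono (by omega)) h4 y).trans
      (congrArg (· * _) (bsum_parity (p := b) (q := c) (by omega) (by omega) y))
  have h2 := fun y => (bsum_mul (B := B + 2) (k := 2) (localBelow_phases (by
    simp [args]; omega)) ((loc2 (by omega) (by omega)).mul (loc4.mono (by omega))) h3 y).trans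
      (congrArg (· * _) (bsum_parity (p := a) (q := c) (by omega) (by omega) y))
  have h1 := fun y => (bsum_mul (B := B) (k := 2) (localBelow_phases (by
    simp [args]; omega)) ((loc2 (by omega) (by omega)).mul ((loc2 (by omega) (by omega)).mul
      (loc4.mono (by omega)))) h2 y).trans
      (congrArg (· * _) (bsum_parity (p := a) (q := b) (by omega) (by omega) y))
  have h0 := bsum_mul (B := B) (k := 0) (F := phases [T a, T b, T c]) (localBelow_phases (by
    simp [args]; omega)) ((loc2 ha hb).mul ((loc2 ha hc).mul ((loc2 hb hc).mul loc4))) h1 y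
  have e : tPhase * tPhase = Complex.I := tPhase_mul_self
  have hI := Complex.I_mul_I
  refine Eq.trans ?_ (h0.trans ?_)
  · refine bsum_congr fun z _ => ?_
    simp only [ccz, phases_append]
    rfl
  · cases hya : y a <;> cases hyb : y b <;> cases hyc : y c <;>
      simp [bsum, phase, sgn, tInv, hya, hyb, hyc]
    all_goals first
      | ring1
      | linear_combination 16 * (tPhase * tPhase + Complex.I) * e + 16 * hI
      | linear_combination 16 * Complex.I ^ 2 * (tPhase * tPhase + Complex.I) * e +
          16 * (Complex.I ^ 2 - 1) * hI

/-! ### The amplitude of the circuit of a 3-CNF -/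

theorem LocalBelow.mul_bsum {B l : ℕ} {F G : (ℕ → Bool) → ℂ} (hF : LocalBelow B F)
    (y : ℕ → Bool) : bsum B l (fun z => F z * G z) y = F y * bsum B l G y := by
  rw [← bsum_const_mul]
  exact bsum_congr fun z hz => by rw [hF z y fun i hi => hz i (Or.inl hi)]

/-- The sums over `zp` and `zq` force `p = ab` and `q = cs`, and then the sum over `z` is `1 +
(-1)^{abcs}`. The constant is `2^3` from these sums times `16^3` from the three cubic phases. -/
theorem sum_core (s a b c : Bool) :
    ∑ p : Bool, ∑ zp : Bool, ∑ q : Bool, ∑ zq : Bool, ∑ z : Bool,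
      sgn (zp && p) * sgn (zq && q) * (16 * sgn (zp && a && b) *
        (16 * sgn (zq && c && s) * (16 * sgn (z && p && q)))) =
      2 ^ 15 * if s && (a && b && c) then 0 else 1 := by
  cases s <;> cases a <;> cases b <;> cases c <;> norm_num [sgn]

theorem bsum_core {B : ℕ} (hB : 0 < B) (y : ℕ → Bool) :
    bsum (B + 6) 29 (phases (coreGates 0 fun r => B + r)) y =
      2 ^ 15 * if y 0 && (y B && y (B + 2) && y (B + 4)) then 0 else 1 := by
  have loc : ∀ {a b c B : ℕ}, a < B → b < B → c < B →
      LocalBelow B fun y => 16 * sgn (y a && y b && y c) :=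
    fun {a b c B} ha hb hc y z h => by simp only [h a ha, h b hb, h c hc]
  have h3 := bsum_ccz (B := B + 27) (a := B + 10) (b := B + 6) (c := B + 8) (by omega) (by omega)
    (by omega)
  have h2 := fun y => (bsum_mul (B := B + 19) (k := 8) (localBelow_phases (by
    simp [ccz, args])) (loc (by omega) (by omega) (by omega)) h3 y).trans
      (congrArg (· * _) (bsum_ccz (a := B + 9) (b := B + 4) (c := 0)
        (by omega) (by omega) (by omega) y))
  have h1 := fun y => (bsum_mul (B := B + 11) (k := 8) (localBelow_phases (by
    simp [ccz, args]; omega)) ((loc (by omega) (by omega) (by omega)).mul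
      (loc (by omega) (by omega) (by omega))) h2 y).trans
      (congrArg (· * _) (bsum_ccz (a := B + 7) (b := B) (c := B + 2)
        (by omega) (by omega) (by omega) y))
  have loc0 : LocalBelow (B + 11) (phases [CZ (B + 7) (B + 6), CZ (B + 9) (B + 8)]) :=
    localBelow_phases (by simp [args])
  -- The five bits `p, zp, q, zq, z` of `sum_core` come first, then the `3 · 8` ancillas of the
  -- cubic phases.
  rw [show 29 = 5 + 24 from rfl, bsum_add, ← sum_core]
  refine (bsum_congr (G := fun y => sgn (y (B + 7) && y (B + 6)) * sgn (y (B + 9) && y (B + 8)) *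
    (16 * sgn (y (B + 7) && y B && y (B + 2)) * (16 * sgn (y (B + 9) && y (B + 4) && y 0) *
      (16 * sgn (y (B + 10) && y (B + 6) && y (B + 8)))))) fun z _ => ?_).trans ?_
  · rw [← h1]
    have := loc0.mul_bsum (l := 24) (G := fun z => phases (ccz (B + 7) B (B + 2)
      fun r => B + 11 + r) z * (phases (ccz (B + 9) (B + 4) 0 fun r => B + 19 + r) z *
        phases (ccz (B + 10) (B + 6) (B + 8) fun r => B + 27 + r) z)) z
    refine Eq.trans (bsum_congr fun w _ => ?_) (this.trans ?_)
    · simp only [coreGates, phases_append, add_assoc]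
      rfl
    · congr 1
      simp [phase, sgn]
  · simp only [bsum, Nat.add_assoc, Nat.reduceAdd]
    simp

/-- The value of a literal when the variables are the qubits `11, 12, …`. -/
def Literal.value {n : ℕ} (l : Literal n) (y : ℕ → Bool) : Bool := xor l.neg (y (11 + l.var))

theorem phases_litGates {n : ℕ} (B i : ℕ) (l : Literal n) (y : ℕ → Bool) :
    phases (litGates B i l) y =
      sgn (y (B + (2 * i + 1)) && xor (y (B + 2 * i)) (!l.value y)) := by
  simp only [litGates, signGates, linkGates, Literal.value]
  cases l.neg <;> cases h1 : y (B + (2 * i + 1)) <;> cases h2 : y (B + 2 * i) <;>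
    cases h3 : y (11 + l.var) <;> simp [phase, sgn, h1, h2, h3]

/-- The copy `u` is forced to be the negation of the literal: a clause fails when all three copies
are `1`, which is what the core gates detect. -/
theorem sum_link (g : Bool → ℂ) (a : Bool) :
    ∑ u : Bool, ∑ z : Bool, sgn (z && xor u (!a)) * g u = 2 * g (!a) := by
  cases a <;> simp [sgn] <;> ring

theorem mem_args_litGates {n : ℕ} (B i : ℕ) (l : Literal n) :
    ∀ g ∈ litGates B i l, ∀ j ∈ g.args, j = 11 + l.var ∨ j = B + 2 * i ∨ j = B + (2 * i + 1) := by
  intro g hg j hj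
  simp only [litGates, signGates, linkGates] at hg
  cases h : l.neg <;> simp [h] at hg <;> rcases hg with rfl | rfl | rfl <;> simp [args] at hj <;>
    omega

/-- The three links contribute `2^3` and fix the inputs of `bsum_core`, whose constant is `2^15`.
With `y 0 = 0` the clause imposes nothing. -/
theorem bsum_clauseGates {n B : ℕ} (hB : 11 + n ≤ B) (c : Literal n × Literal n × Literal n)
    (y : ℕ → Bool) :
    bsum B 35 (phases (clauseGates B c)) y = 2 ^ 18 *
      if y 0 && !(c.1.value y || c.2.1.value y || c.2.2.value y) then 0 else 1 := by
  have h0 := c.1.var.isLt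
  have h1 := c.2.1.var.isLt
  have h2 := c.2.2.var.isLt
  have hloc : ∀ (l : Literal n) (i : ℕ), i ≤ 2 → LocalBelow (B + 6) (phases (litGates B i l)) :=
    fun l i hi => localBelow_phases fun g hg j hj => by
      have := l.var.isLt
      have := mem_args_litGates B i l g hg j hj
      omega
  have h3 := bsum_add B 6 29 (phases (clauseGates B c)) y
  rw [h3]
  refine (bsum_congr (G := fun z => sgn (z (B + 1) && xor (z B) (!c.1.value y)) *
    (sgn (z (B + 3) && xor (z (B + 2)) (!c.2.1.value y)) *
    (sgn (z (B + 5) && xor (z (B + 4)) (!c.2.2.value y)) *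
    (2 ^ 15 * if y 0 && (z B && z (B + 2) && z (B + 4)) then 0 else 1)))) fun z hz => ?_).trans ?_
  · have e : ∀ l : Literal n, l.value y = l.value z := fun l => by
      have := l.var.isLt
      simp only [Literal.value]
      rw [hz _ (by omega)]
    rw [e, e, e, ← hz 0 (by omega), ← bsum_core (by omega)]
    have h4 := ((hloc c.1 0 (by omega)).mul ((hloc c.2.1 1 (by omega)).mul
      (hloc c.2.2 2 (by omega)))).mul_bsum (l := 29)
      (G := phases (coreGates 0 fun r => B + r)) z
    refine Eq.trans (bsum_congr fun w _ => ?_) (h4.trans ?_)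
    · simp only [clauseGates, phases_append, mul_assoc]
    · simp only [phases_litGates, mul_assoc, mul_zero, add_zero, zero_add, mul_one]
  · generalize c.1.value y = a₀, c.2.1.value y = a₁, c.2.2.value y = a₂, y 0 = s
    trans ∑ u₀ : Bool, ∑ z₀ : Bool, sgn (z₀ && xor u₀ (!a₀)) *
      ∑ u₁ : Bool, ∑ z₁ : Bool, sgn (z₁ && xor u₁ (!a₁)) *
      ∑ u₂ : Bool, ∑ z₂ : Bool, sgn (z₂ && xor u₂ (!a₂)) *
      (2 ^ 15 * if s && (u₀ && u₁ && u₂) then 0 else 1)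
    · simp only [Finset.mul_sum]
      simp only [bsum, Nat.add_assoc, Nat.reduceAdd]
      simp
    · simp only [sum_link]
      cases s <;> cases a₀ <;> cases a₁ <;> cases a₂ <;> norm_num

/-- The value of a list of clauses when the variables are the qubits `11, 12, …`. -/
def clausesValue {n : ℕ} (cs : List (Literal n × Literal n × Literal n)) (y : ℕ → Bool) : Bool :=
  cs.all fun c => c.1.value y || c.2.1.value y || c.2.2.value y

theorem clausesValue_congr {n : ℕ} (cs : List (Literal n × Literal n × Literal n))
    {y z : ℕ → Bool} (h : ∀ i < 11 + n, y i = z i) : clausesValue cs y = clausesValue cs z := by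
  have e : ∀ l : Literal n, l.value y = l.value z := fun l => by
    have := l.var.isLt
    simp only [Literal.value]
    rw [h _ (by omega)]
  simp only [clausesValue, e]

theorem lt_of_mem_args_clauseGates {n B : ℕ} (hB : 11 + n ≤ B)
    (c : Literal n × Literal n × Literal n) :
    ∀ g ∈ clauseGates B c, ∀ i ∈ g.args, i < B + 35 := by
  have hl : ∀ (l : Literal n) (i : ℕ), i ≤ 2 → ∀ g ∈ litGates B i l, ∀ i ∈ g.args, i < B + 35 := by
    intro l i hi g hg j hj
    have := l.var.isLt
    have := mem_args_litGates B i l g hg j hj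
    omega
  intro g hg
  simp only [clauseGates, List.mem_append] at hg
  rcases hg with hg | hg | hg | hg
  · exact hl _ _ (by omega) g hg
  · exact hl _ _ (by omega) g hg
  · exact hl _ _ (by omega) g hg
  · revert g
    simp [coreGates, ccz, args]

theorem bsum_clausesGates {n : ℕ} (cs : List (Literal n × Literal n × Literal n)) {B : ℕ}
    (hB : 11 + n ≤ B) (y : ℕ → Bool) :
    bsum B (35 * cs.length) (phases (clausesGates B cs)) y =
      2 ^ (18 * cs.length) * if y 0 && !clausesValue cs y then 0 else 1 := by
  induction cs generalizing B y with
  | nil => simp [bsum, clausesGates, clausesValue]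
  | cons c cs ih =>
    have h := bsum_mul (B := B) (k := 35) (localBelow_phases (lt_of_mem_args_clauseGates hB c))
      (fun y z h => by
        simp only [h 0 (by omega), clausesValue_congr cs fun i hi => h i (by omega)])
      (fun y => ih (B := B + 35) (by omega) y) y
    rw [List.length_cons, show 35 * (cs.length + 1) = 35 + 35 * cs.length by ring]
    refine Eq.trans (bsum_congr fun z _ => ?_) (h.trans ?_)
    · rw [clausesGates, phases_append]
    · rw [bsum_clauseGates hB]
      have e : clausesValue (c :: cs) y =
        ((c.1.value y || c.2.1.value y || c.2.2.value y) && clausesValue cs y) := rfl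
      rw [e, show 18 * (cs.length + 1) = 18 + 18 * cs.length by ring, pow_add]
      cases y 0 <;> cases (c.1.value y || c.2.1.value y || c.2.2.value y) <;>
        cases clausesValue cs y <;> simp

/-- Write `s` for the bit `0`. The clauses leave `2^n` assignments for `s = 0` and the `#f`
satisfying ones for `s = 1`. The sum over `u, v` of `(-1)^{s + uv(1 - s)}` is `2` and `-4`
respectively, giving `2 · 2^n - 4 · #f = 2 gap(f)`; the cubic phase of the weight supplies the
remaining `16`. -/
theorem bsum_diagGates (f : CNF3) (y : ℕ → Bool) :
    bsum 0 f.qubits (phases f.diagGates) y = 32 * 2 ^ (18 * f.m) * (f.gap : ℂ) := by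
  obtain ⟨n, cs⟩ := f
  have hgap : ((CNF3.gap ⟨n, cs⟩ : ℤ) : ℂ) =
      2 ^ n - 2 * ∑ x : Fin n → Bool, if CNF3.eval ⟨n, cs⟩ x then 1 else 0 := by
    have h2 : (2 : ℂ) ^ n = ∑ x : Fin n → Bool, 1 := by simp
    rw [CNF3.gap, h2, Finset.mul_sum, ← Finset.sum_sub_distrib, Int.cast_sum]
    refine Finset.sum_congr rfl fun x _ => ?_
    cases CNF3.eval ⟨n, cs⟩ x <;> norm_num
  have h1 : ∀ y, bsum 11 (n + 35 * cs.length) (phases (clausesGates (11 + n) cs)) y =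
      2 ^ (18 * cs.length) * if y 0 then
        ∑ x : Fin n → Bool, if CNF3.eval ⟨n, cs⟩ x then 1 else 0 else 2 ^ n := by
    intro y
    rw [bsum_add]
    refine (bsum_congr (G := fun z => 2 ^ (18 * cs.length) *
      if y 0 && !clausesValue cs z then 0 else 1) fun z hz => ?_).trans ?_
    · rw [bsum_clausesGates cs le_rfl, hz 0 (by omega)]
    · rw [bsum_const_mul, bsum_eq_sum 11 n (fun z => if y 0 && !clausesValue cs z then 0 else 1)
          (fun x => if y 0 && !CNF3.eval ⟨n, cs⟩ x then 0 else 1)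
        (fun z => rfl)]
      cases y 0
      · simp
      · simp only [Bool.true_and, if_true]
        congr 1
        refine Finset.sum_congr rfl fun x _ => ?_
        cases CNF3.eval ⟨n, cs⟩ x <;> rfl
  have h2 := fun y => (bsum_mul (B := 3) (k := 8)
    (localBelow_phases (gs := ccz 0 1 2 fun r => 3 + r) (by simp [ccz, args]))
    (fun y z h => by simp only [h 0 (by omega)]) h1 y).trans
      (congrArg (· * _) (bsum_ccz (by omega) (by omega) (by omega) y))
  have h3 : LocalBelow 3 (phases [S 0, S 0, CZ 1 2]) := localBelow_phases (by simp [args])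
  -- The bits `s, u, v`, the ancillas of the weight, the variables, and the clause blocks.
  have e : CNF3.qubits ⟨n, cs⟩ = 3 + (8 + (n + 35 * cs.length)) := by
    simp only [CNF3.qubits, CNF3.m]; omega
  rw [hgap, e, bsum_add]
  refine (bsum_congr fun z _ => (Eq.trans (bsum_congr fun w _ => ?_)
    (h3.mul_bsum z)).trans (congrArg _ (h2 z))).trans ?_
  · simp only [CNF3.diagGates, weightGates, phases_append, mul_assoc]
    rfl
  · simp [bsum, phase, sgn, CNF3.m]
    ring

/-! ### From gates on natural numbers to circuits -/

/-- A finite assignment, continued by `false`. -/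
def extend {N : ℕ} (x : Fin N → Bool) (i : ℕ) : Bool :=
  if h : i < N then x ⟨i, h⟩ else false

theorem extend_update {N : ℕ} (x : Fin N → Bool) (i : Fin N) (b : Bool) :
    extend (Function.update x i b) = Function.update (extend x) i b := by
  funext j
  by_cases hj : j < N
  · by_cases h : j = i
    · subst h; simp [extend]
    · have : (⟨j, hj⟩ : Fin N) ≠ i := fun e => h (congrArg Fin.val e)
      simp [extend, hj, h, Function.update_of_ne this]
  · have : j ≠ i := fun e => hj (e ▸ i.isLt)
    simp [extend, hj, Function.update_of_ne this]

@[simp] theorem extend_val {N : ℕ} (x : Fin N → Bool) (i : Fin N) :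
    extend x i = x i := by simp [extend]

namespace QGate

/-- A gate on `N` qubits with distinct arguments. -/
def Valid (N : ℕ) (g : QGate ℕ) : Prop := (∀ i ∈ g.args, i < N) ∧ g.args.Nodup

/-- Diagonal gates, that is, all gates but `H`. -/
def IsDiag : QGate ℕ → Prop
  | .H _ => False
  | _ => True

/-- Whether a gate is a `T` gate. -/
def isT : QGate ℕ → Bool
  | .T _ => true
  | _ => false

/-- A gate as a gate on `N` qubits. -/
def toGate (N : ℕ) [NeZero N] : QGate ℕ → Gate N
  | .H i => .H (Fin.ofNat N i)
  | .S i => .S (Fin.ofNat N i)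
  | .CZ i j => if h : Fin.ofNat N i ≠ Fin.ofNat N j then .CZ _ _ h else .H (Fin.ofNat N i)
  | .T i => .T (Fin.ofNat N i)

/-- The action of a gate on a state with infinitely many qubits. -/
noncomputable def act (g : QGate ℕ) (Ψ : (ℕ → Bool) → ℂ) : (ℕ → Bool) → ℂ :=
  match g with
  | .H i => fun y => (1 / (Real.sqrt 2 : ℂ)) *
      (Ψ (Function.update y i false) + (if y i then -1 else 1) * Ψ (Function.update y i true))
  | g => fun y => g.phase y * Ψ y

variable {N : ℕ} [NeZero N]

theorem isT_toGate (g : QGate ℕ) : (g.toGate N).isT = g.isT := by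
  cases g <;> simp only [toGate, isT, Gate.isT]
  split_ifs <;> rfl

theorem ofNat_ne {i j : ℕ} (hi : i < N) (hj : j < N) (h : i ≠ j) :
    Fin.ofNat N i ≠ Fin.ofNat N j := fun e => h (by
  have := congrArg Fin.val e
  simpa [Nat.mod_eq_of_lt, hi, hj] using this)

/-- Validity rules out both wraparound in `Fin.ofNat` and the fallback of `toGate` for a `CZ` with
equal arguments. -/
theorem encode_toGate {g : QGate ℕ} (hg : g.Valid N) : true :: (g.toGate N).encode = g.encode := by
  obtain ⟨h1, h2⟩ := hg
  cases g with
  | CZ i j =>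
    simp only [args, List.mem_cons, List.not_mem_nil, or_false, forall_eq_or_imp, forall_eq,
      List.nodup_cons, not_false_eq_true, List.nodup_nil, and_true] at h1 h2
    rw [toGate, dif_pos (ofNat_ne h1.1 h1.2 h2)]
    simp [encode, Gate.encode, op, args, Nat.mod_eq_of_lt, h1]
  | _ => simp_all [toGate, encode, Gate.encode, op, args, Nat.mod_eq_of_lt]

theorem act_toGate {g : QGate ℕ} (hg : g.Valid N) (Ψ : (ℕ → Bool) → ℂ) :
    (g.toGate N).act (fun x => Ψ (extend x)) = fun x => g.act Ψ (extend x) := by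
  obtain ⟨h1, h2⟩ := hg
  have e : ∀ (x : Fin N → Bool) (i : ℕ), i < N → extend x i = x (Fin.ofNat N i) := by
    intro x i hi
    rw [← extend_val x, Fin.val_ofNat, Nat.mod_eq_of_lt hi]
  funext x
  cases g with
  | CZ i j =>
    simp only [args, List.mem_cons, List.not_mem_nil, or_false, forall_eq_or_imp, forall_eq,
      List.nodup_cons, not_false_eq_true, List.nodup_nil, and_true] at h1 h2
    rw [toGate, dif_pos (ofNat_ne h1.1 h1.2 h2)]
    simp [act, Gate.act, phase, e, h1]
  | _ => simp_all [toGate, act, Gate.act, args, phase, tPhase, extend_update, Nat.mod_eq_of_lt]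

theorem foldl_act_toGate {gs : List (QGate ℕ)} (hgs : ∀ g ∈ gs, g.Valid N)
    (Ψ : (ℕ → Bool) → ℂ) :
    (gs.map (toGate N)).foldl (fun ψ g => g.act ψ) (fun x => Ψ (extend x)) =
      fun x => gs.foldl (fun Ψ g => g.act Ψ) Ψ (extend x) := by
  induction gs generalizing Ψ with
  | nil => rfl
  | cons g gs ih =>
    rw [List.map_cons, List.foldl_cons, act_toGate (hgs g (by simp)),
      ih fun g hg => hgs g (by simp [hg])]
    rfl

end QGate

/-! ### Hadamard layers around a diagonal circuit -/

theorem foldl_act_diag {gs : List (QGate ℕ)} (hgs : ∀ g ∈ gs, g.IsDiag) (Ψ : (ℕ → Bool) → ℂ) :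
    gs.foldl (fun Ψ g => g.act Ψ) Ψ = fun y => phases gs y * Ψ y := by
  induction gs generalizing Ψ with
  | nil => simp
  | cons g gs ih =>
    have hg := hgs g (by simp)
    rw [List.foldl_cons, ih fun g hg => hgs g (by simp [hg])]
    funext y
    cases g with
    | H i => exact hg.elim
    | _ => simp only [phases_cons, act]; ring

/-- The state that is `|0⟩` on the first `k` qubits. -/
noncomputable def zeros (k : ℕ) (y : ℕ → Bool) : ℂ := if ∀ i < k, y i = false then 1 else 0

theorem foldl_act_hadamards_zeros (k : ℕ) (c : ℂ) :
    (hadamards k).foldl (fun Ψ g => g.act Ψ) (fun y => c * zeros k y) =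
      fun _ => c * (1 / (Real.sqrt 2 : ℂ)) ^ k := by
  induction k generalizing c with
  | zero => simp [hadamards, zeros]
  | succ k ih =>
    have h : (QGate.H k).act (fun y => c * zeros (k + 1) y) =
        fun y => c * (1 / (Real.sqrt 2 : ℂ)) * zeros k y := by
      funext y
      have h1 : zeros (k + 1) (Function.update y k true) = 0 :=
        if_neg fun h => by simpa using h k (by omega)
      have h2 : zeros (k + 1) (Function.update y k false) = zeros k y := by
        refine if_congr ⟨fun h i hi => ?_, fun h i hi => ?_⟩ rfl rfl
        · simpa [hi.ne] using h i (by omega)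
        · rcases Nat.lt_succ_iff_lt_or_eq.1 hi with hi | rfl
          · simpa [hi.ne] using h i hi
          · simp
      simp only [QGate.act, h1, h2]
      ring
    rw [hadamards, List.foldl_cons, h, ih, pow_succ']
    funext _
    ring

/-- At an all-zero output every Hadamard sign is `+1`, so the layer just sums its input. -/
theorem foldl_act_hadamards (k : ℕ) (Ψ : (ℕ → Bool) → ℂ) {y : ℕ → Bool}
    (hy : ∀ i < k, y i = false) :
    (hadamards k).foldl (fun Ψ g => g.act Ψ) Ψ y =
      (1 / (Real.sqrt 2 : ℂ)) ^ k * bsum 0 k Ψ y := by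
  induction k generalizing Ψ with
  | zero => simp [hadamards, bsum]
  | succ k ih =>
    rw [hadamards, List.foldl_cons, ih _ fun i hi => hy i (by omega), bsum_add, pow_succ, mul_assoc]
    congr 1
    rw [← bsum_const_mul]
    refine bsum_congr fun z hz => ?_
    have : z k = false := (hz k (by omega)).trans (hy k (by omega))
    simp [QGate.act, this, bsum, add_comm]

/-! ### The circuit of a 3-CNF -/

instance (f : CNF3) : NeZero f.qubits := ⟨by rw [CNF3.qubits]; omega⟩

/-- The circuit of a 3-CNF. -/
def CNF3.circuit (f : CNF3) : CliffordT := ⟨f.qubits, f.circuitGates.map (toGate f.qubits)⟩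

theorem valid_hadamards {k N : ℕ} (h : k ≤ N) : ∀ g ∈ hadamards k, g.Valid N := by
  induction k with
  | zero => simp [hadamards]
  | succ k ih =>
    simp only [hadamards, List.forall_mem_cons]
    exact ⟨⟨by simp [args]; omega, by simp [args]⟩, ih (by omega)⟩

theorem valid_isDiag_litGates {n B i N : ℕ} (hi : i ≤ 2) (hB : 11 + n ≤ B) (hN : B + 35 ≤ N)
    (l : Literal n) : ∀ g ∈ litGates B i l, g.Valid N ∧ g.IsDiag := by
  intro g hg
  have := l.var.isLt
  refine ⟨⟨fun j hj => ?_, ?_⟩, ?_⟩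
  · have := mem_args_litGates B i l g hg j hj
    omega
  all_goals
    simp only [litGates, signGates, linkGates] at hg
    cases h : l.neg <;> simp [h] at hg <;> rcases hg with rfl | rfl | rfl <;>
      simp [args, IsDiag] <;> omega

theorem valid_isDiag_clausesGates {n N : ℕ} (cs : List (Literal n × Literal n × Literal n)) {B : ℕ}
    (hB : 11 + n ≤ B) (hN : B + 35 * cs.length ≤ N) :
    ∀ g ∈ clausesGates B cs, g.Valid N ∧ g.IsDiag := by
  induction cs generalizing B with
  | nil => simp [clausesGates]
  | cons c cs ih =>
    rw [List.length_cons] at hN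
    intro g hg
    simp only [clausesGates, clauseGates, List.mem_append] at hg
    rcases hg with (hg | hg | hg | hg) | hg
    · exact valid_isDiag_litGates (by omega) hB (by omega) _ g hg
    · exact valid_isDiag_litGates (by omega) hB (by omega) _ g hg
    · exact valid_isDiag_litGates (by omega) hB (by omega) _ g hg
    · revert g
      simp [coreGates, ccz, args, Valid, IsDiag]
      omega
    · exact ih (by omega) (by omega) g hg

theorem valid_isDiag_diagGates (f : CNF3) : ∀ g ∈ f.diagGates, g.Valid f.qubits ∧ g.IsDiag := by
  intro g hg
  rw [CNF3.diagGates, List.mem_append] at hg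
  rcases hg with hg | hg
  · revert g
    simp [weightGates, ccz, args, Valid, IsDiag, CNF3.qubits]
    omega
  · exact valid_isDiag_clausesGates f.clauses le_rfl le_rfl g hg

theorem valid_circuitGates (f : CNF3) : ∀ g ∈ f.circuitGates, g.Valid f.qubits := by
  intro g hg
  simp only [CNF3.circuitGates, List.mem_append] at hg
  rcases hg with hg | hg | hg
  · exact valid_hadamards le_rfl g hg
  · exact (valid_isDiag_diagGates f g hg).1
  · exact valid_hadamards le_rfl g hg

theorem CNF3.encode_circuit (f : CNF3) : f.circuit.encode = f.circuitCode := by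
  rw [CliffordT.encode, CNF3.circuitCode]
  congr 2
  simp only [CNF3.circuit, List.flatMap_map]
  exact List.flatMap_congr fun g hg => encode_toGate (valid_circuitGates f g hg)

theorem CNF3.pacc_circuit_ne_zero_iff (f : CNF3) : f.circuit.pacc ≠ 0 ↔ f.gap ≠ 0 := by
  have h0 : zeroState f.qubits = fun x => (fun y => 1 * zeros f.qubits y) (extend x) := by
    funext x
    simp only [zeroState, zeros, one_mul]
    refine if_congr ⟨fun h i hi => by simp [h, extend], fun h => funext fun i => ?_⟩ rfl rfl
    simpa using h i i.isLt
  have h1 : ∀ i < f.qubits, extend (fun _ : Fin f.qubits => false) i = false :=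
    fun i hi => by simp [extend]
  have h2 := foldl_act_toGate (valid_circuitGates f) fun y => 1 * zeros f.qubits y
  rw [← h0] at h2
  have h3 : (Real.sqrt 2 : ℂ) ≠ 0 := by simp
  rw [CliffordT.pacc]
  simp only [CNF3.circuit]
  rw [h2, CNF3.circuitGates, List.foldl_append, List.foldl_append]
  beta_reduce
  rw [foldl_act_hadamards _ _ h1,
    foldl_act_hadamards_zeros, foldl_act_diag fun g hg => (valid_isDiag_diagGates f g hg).2]
  simp only [mul_comm (phases _ _), bsum_const_mul, bsum_diagGates]
  simp

/-- Only cubic phases use `T` gates: three per clause and one for the weight, seven gates each. The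
count is linear in `m` and independent of `n`, so time `2^{o(t)}` is time `2^{o(m)}`. -/
theorem CNF3.tCount_circuit (f : CNF3) : f.circuit.tCount = 21 * f.m + 7 := by
  have hH : ∀ k, (hadamards k).countP isT = 0 := fun k => by
    induction k with
    | zero => rfl
    | succ k ih => simp [hadamards, ih, isT]
  have hQ : ∀ (a b c : ℕ) (q : ℕ → ℕ), (ccz a b c q).countP isT = 7 := fun _ _ _ _ => rfl
  have hL : ∀ {n : ℕ} (B i : ℕ) (l : Literal n), (litGates B i l).countP isT = 0 := by
    intro n B i l
    simp only [litGates, signGates, linkGates]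
    cases l.neg <;> simp [isT]
  have hC : ∀ {n : ℕ} (cs : List (Literal n × Literal n × Literal n)) (B : ℕ),
      (clausesGates B cs).countP isT = 21 * cs.length := by
    intro n cs
    induction cs with
    | nil => simp [clausesGates]
    | cons c cs ih =>
      intro B
      simp only [clausesGates, clauseGates, List.countP_append, hL, ih, coreGates, hQ]
      simp [isT]
      ring
  have e : (Gate.isT ∘ toGate f.qubits) = isT := funext isT_toGate
  rw [CliffordT.tCount, CNF3.circuit, List.countP_map, e]
  simp only [CNF3.circuitGates, CNF3.diagGates, List.countP_append, hH, hC, weightGates,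
    hQ]
  simp [isT, CNF3.m]
  ring

theorem CNF3.size_circuit_le (f : CNF3) (h : f.n ≤ 3 * f.m) :
    f.circuit.size ≤ 300 * f.m + 100 := by
  have hH : ∀ k, (hadamards k).length = k := fun k => by
    induction k with
    | zero => rfl
    | succ k ih => simp [hadamards, ih]
  have hL : ∀ {n : ℕ} (B i : ℕ) (l : Literal n), (litGates B i l).length ≤ 4 := by
    intro n B i l
    simp only [litGates, signGates, linkGates]
    cases l.neg <;> simp
  -- At most `4` gates for each of three literals and `2 + 3 · 29` core gates.
  have hC : ∀ {n : ℕ} (cs : List (Literal n × Literal n × Literal n)) (B : ℕ),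
      (clausesGates B cs).length ≤ 101 * cs.length := by
    intro n cs
    induction cs with
    | nil => simp [clausesGates]
    | cons c cs ih =>
      intro B
      have h1 := hL B 0 c.1
      have h2 := hL B 1 c.2.1
      have h3 := hL B 2 c.2.2
      have h4 := ih (B + 35)
      simp only [clausesGates, clauseGates, List.length_append, coreGates, ccz, List.length_cons,
        List.length_nil] at *
      omega
  have h1 := hC f.clauses (11 + f.n)
  have h2 : (weightGates (α := ℕ) id).length = 32 := rfl
  simp only [CliffordT.size, CNF3.circuit, List.length_map, CNF3.circuitGates, CNF3.diagGates,
    List.length_append, hH, h2]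
  simp only [CNF3.qubits, CNF3.m] at *
  omega

/-! ### Halting and acceptance -/

/-- All computation paths from `c` halt within `T` steps. -/
def Config.HaltsBy (c : Config) (T : ℕ) : Prop := ∀ w : List Bool, T ≤ w.length → (c.run w).Halted

/-- Some computation path from `c` accepts. -/
def Config.CanAccept (c : Config) : Prop := ∃ w : List Bool, (c.run w).Accepting

/-- All computation paths from `c` lead to `c'` within `n` steps. -/
def Config.Reaches (c c' : Config) (n : ℕ) : Prop :=
  ∃ t ≤ n, ∀ w : List Bool, w.length = t → c.run w = c'

namespace Config

variable {c c' c'' : Config} {T U n : ℕ}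

theorem Accepting.run_append {u : List Bool} (h : (c.run u).Accepting) (w : List Bool) :
    (c.run (u ++ w)).Accepting := by
  rwa [Config.run_append, run_halted h.1]

theorem HaltsBy.mono (h : c.HaltsBy T) (hTU : T ≤ U) : c.HaltsBy U :=
  fun w hw => h w (hTU.trans hw)

theorem Reaches.trans (h : Reaches c c' n) (h' : Reaches c' c'' T) : Reaches c c'' (n + T) := by
  obtain ⟨t, ht, h⟩ := h
  obtain ⟨u, hu, h'⟩ := h'
  refine ⟨t + u, by omega, fun w hw => ?_⟩
  rw [← List.take_append_drop t w, run_append, h _ (by simp [hw]), h' _ (by simp [hw])]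

theorem Reaches.of_step (h : ∀ b, c.step b = c') : Reaches c c' 1 := by
  refine ⟨1, le_rfl, fun w hw => ?_⟩
  obtain ⟨b, rfl⟩ := List.length_eq_one_iff.1 hw
  exact h b

theorem _root_.FineGrained.Prog.Exec.reaches {p : Prog} {σ σ' : ℕ → List Bool}
    (h : p.Exec σ σ' n) (k : List Prog) : Reaches ⟨p :: k, σ⟩ ⟨k, σ'⟩ n :=
  let ⟨t, ht, h⟩ := h
  ⟨t, ht, h k⟩

theorem Reaches.haltsBy (h : Reaches c c' n) (h' : c'.HaltsBy T) : c.HaltsBy (n + T) := by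
  obtain ⟨t, ht, h⟩ := h
  intro w hw
  rw [← List.take_append_drop t w, run_append, h _ (by simp; omega)]
  exact h' _ (by simp; omega)

theorem Reaches.canAccept_iff (h : Reaches c c' n) : c.CanAccept ↔ c'.CanAccept := by
  obtain ⟨t, ht, h⟩ := h
  constructor
  · rintro ⟨w, hw⟩
    have h1 := hw.run_append (List.replicate t false)
    rw [← List.take_append_drop t (w ++ _), run_append, h _ (by simp)] at h1
    exact ⟨_, h1⟩
  · rintro ⟨w, hw⟩
    refine ⟨List.replicate t false ++ w, ?_⟩
    rwa [run_append, h _ (by simp)]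

end Config

/-- Halted configurations do not move, so words of length exactly `T` decide the matter for all
longer ones. The version without a fixed length is the one that composes. -/
theorem Prog.haltsWithin_iff {M : Prog} {x : List Bool} {T : ℕ} :
    M.HaltsWithin x T ↔ (M.init x).HaltsBy T := by
  constructor
  · intro h w hw
    have h1 := h fun i => (w.take T).get (Fin.cast (by simp [hw]) i)
    have h2 : List.ofFn (fun i : Fin T => (w.take T).get (Fin.cast (by simp [hw]) i)) =
        w.take T := by
      apply List.ext_get <;> simp [hw]
    rw [h2] at h1
    rwa [← List.take_append_drop T w, Config.run_append, Config.run_halted h1]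
  · exact fun h w => h _ (by simp)

theorem Prog.ndAccepts_iff {M : Prog} {x : List Bool} {T : ℕ} (h : (M.init x).HaltsBy T) :
    M.NDAccepts x T ↔ (M.init x).CanAccept := by
  constructor
  · rintro ⟨w, hw⟩
    exact ⟨_, hw⟩
  · rintro ⟨w, hw⟩
    have h0 := hw.run_append (List.replicate T false)
    have hlen : T ≤ (w ++ List.replicate T false).length := by simp
    generalize w ++ List.replicate T false = w at h0 hlen
    refine ⟨fun i => (w.take T).get (Fin.cast (by simp [hlen]) i), ?_⟩
    have h2 : List.ofFn (fun i : Fin T => (w.take T).get (Fin.cast (by simp [hlen]) i)) =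
        w.take T := by
      apply List.ext_get <;> simp [hlen]
    rw [h2]
    rwa [← List.take_append_drop T w, Config.run_append,
      Config.run_halted (h _ (by simp [hlen]))] at h0

/-- `M` halts within `T` steps on the description of `V`, and some computation path accepts if and
only if the acceptance probability of `V` is nonzero. -/
def DetectsNonzero (M : Prog) (V : CliffordT) (T : ℕ) : Prop :=
  (M.init V.encode).HaltsBy T ∧ ((M.init V.encode).CanAccept ↔ V.pacc ≠ 0)

theorem DetectsNonzero.mono {M : Prog} {V : CliffordT} {T U : ℕ} (h : DetectsNonzero M V T)
    (hTU : T ≤ U) : DetectsNonzero M V U :=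
  ⟨h.1.mono hTU, h.2⟩

/-- If `q = 0`, the error bound reads `p ≤ ε p`, so `p = 0` because `ε < 1`. If `p = 0`, it reads
`|q| ≤ 0`. A positive acceptance probability means that some path accepts. -/
theorem Samples.detectsNonzero {M : Prog} {V : CliffordT} {T : ℕ} {ε : ℝ} (hε : ε < 1)
    (h : Samples M V T ε) : DetectsNonzero M V T := by
  obtain ⟨h1, h2⟩ := h
  rw [Prog.haltsWithin_iff] at h1
  refine ⟨h1, ?_⟩
  have hq : M.NDAccepts V.encode T ↔ M.acceptProb V.encode T ≠ 0 := by
    rw [Prog.acceptProb, div_ne_zero_iff, Nat.cast_ne_zero, Finset.card_ne_zero]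
    simp [Prog.NDAccepts, Finset.filter_nonempty_iff]
  have hp : 0 ≤ V.pacc := sq_nonneg _
  rw [← Prog.ndAccepts_iff h1, hq, not_iff_not]
  constructor
  · intro h0
    rw [h0, sub_zero, abs_of_nonneg hp] at h2
    nlinarith
  · intro h0
    rw [h0, mul_zero, zero_sub, abs_neg] at h2
    exact abs_nonpos_iff.1 h2

/-! ### Injectivity of the description of 3-CNFs -/

theorem unary_append_inj {a b : ℕ} {x y : List Bool} (h : unary a ++ x = unary b ++ y) :
    a = b ∧ x = y := by
  induction a generalizing b with
  | zero => cases b <;> simp_all [unary, List.replicate_succ]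
  | succ a ih =>
    cases b with
    | zero => simp [unary, List.replicate_succ] at h
    | succ b =>
      have := ih (b := b) (by simpa [unary, List.replicate_succ] using h)
      exact ⟨by rw [this.1], this.2⟩

theorem Literal.encode_append_inj {n : ℕ} {a b : Literal n} {x y : List Bool}
    (h : a.encode ++ x = b.encode ++ y) : a = b ∧ x = y := by
  obtain ⟨v, s⟩ := a
  obtain ⟨v', s'⟩ := b
  simp only [Literal.encode, List.cons_append, List.cons.injEq] at h
  obtain ⟨h1, h2⟩ := unary_append_inj h.2
  exact ⟨by rw [h.1, Fin.ext h1], h2⟩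

theorem encodeClauses_injective (n : ℕ) :
    Function.Injective (encodeClauses (n := n)) := by
  intro cs cs' h
  induction cs generalizing cs' with
  | nil => cases cs' <;> simp [encodeClauses] at h ⊢
  | cons c cs ih =>
    cases cs' with
    | nil => simp [encodeClauses] at h
    | cons c' cs' =>
      have h' : c.1.encode ++ (c.2.1.encode ++ (c.2.2.encode ++ encodeClauses cs)) =
          c'.1.encode ++ (c'.2.1.encode ++ (c'.2.2.encode ++ encodeClauses cs')) := by
        simpa [encodeClauses] using h
      obtain ⟨h1, h'⟩ := Literal.encode_append_inj h'
      obtain ⟨h2, h'⟩ := Literal.encode_append_inj h'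
      obtain ⟨h3, h'⟩ := Literal.encode_append_inj h'
      rw [ih h', Prod.ext h1 (Prod.ext h2 h3)]

/-- Needed for the lookup table, where a description has to determine the gap. -/
theorem CNF3.encode_injective : Function.Injective CNF3.encode := by
  rintro ⟨n, cs⟩ ⟨n', cs'⟩ h
  have e : ∀ f : CNF3, f.encode = unary f.n ++ encodeClauses f.clauses :=
    fun f => List.append_assoc _ _ _
  rw [e, e] at h
  obtain ⟨h1, h2⟩ := unary_append_inj h
  dsimp only at h1
  subst h1
  exact congrArg _ (encodeClauses_injective n h2)

theorem CNF3.length_encode_le (f : CNF3) (h : f.n ≤ 3 * f.m) :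
    f.encode.length ≤ 9 * f.m ^ 2 + 10 * f.m + 2 := by
  obtain ⟨n, cs⟩ := f
  have hl : ∀ l : Literal n, l.encode.length ≤ n + 1 := fun l => by
    have := l.var.isLt
    simp [Literal.encode, unary]
  have hc : (cs.flatMap fun c => true :: (c.1.encode ++ c.2.1.encode ++ c.2.2.encode)).length ≤
      cs.length * (3 * n + 4) := by
    clear h
    induction cs with
    | nil => simp
    | cons c cs ih =>
      have h1 := hl c.1
      have h2 := hl c.2.1
      have h3 := hl c.2.2
      simp only [List.flatMap_cons, List.length_append, List.length_cons] at ih ⊢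
      linarith [Nat.succ_mul cs.length (3 * n + 4)]
  simp only [CNF3.m, CNF3.encode, List.length_append, unary, List.length_replicate,
    List.length_singleton] at h ⊢
  nlinarith

/-! ### Treating finitely many inputs by a lookup table -/

/-- Read up to `d` bits from stack `0`; if the input ends before, answer by the table `g` (of
reversed words), otherwise restore the input and run `p`. -/
def Prog.lookup (g : List Bool → Bool) (p : Prog) : ℕ → List Bool → Prog
  | 0, acc => .seq (.pushList 0 acc) p
  | d + 1, acc => .pop 0 (.push 0 (g acc)) (lookup g p d (false :: acc)) (lookup g p d (true :: acc))

theorem Prog.exec_lookup_of_lt {g : List Bool → Bool} {p : Prog} {d : ℕ} {acc l : List Bool}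
    {σ : ℕ → List Bool} (hσ : σ 0 = l) (hl : l.length < d) :
    (Prog.lookup g p d acc).Exec σ (Function.update σ 0 [g (l.reverse ++ acc)]) (d + 1) := by
  induction d generalizing acc l σ with
  | zero => omega
  | succ d ih =>
    rw [Prog.lookup]
    cases l with
    | nil =>
      have h := Prog.Exec.push (σ := σ) 0 (g acc)
      rw [hσ] at h
      exact (Prog.Exec.pop_nil hσ h).mono (by omega)
    | cons b l =>
      have h := ih (acc := b :: acc) (l := l) (σ := Function.update σ 0 l) (by simp)
        (by simpa using hl)
      rw [Function.update_idem] at h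
      rw [List.reverse_cons, List.append_assoc, List.singleton_append]
      cases b
      · exact Prog.Exec.pop_false hσ h
      · exact Prog.Exec.pop_true hσ h

theorem Prog.reaches_lookup_of_le {g : List Bool → Bool} {p : Prog} {d : ℕ} {acc l : List Bool}
    {σ : ℕ → List Bool} (hσ : σ 0 = l) (hl : d ≤ l.length) :
    Config.Reaches ⟨[Prog.lookup g p d acc], σ⟩ ⟨[p], Function.update σ 0 (acc.reverse ++ l)⟩
      (3 * d + 2 * acc.length + 2) := by
  induction d generalizing acc l σ with
  | zero =>
    have h1 : Config.Reaches ⟨[Prog.lookup g p 0 acc], σ⟩ ⟨[.pushList 0 acc, p], σ⟩ 1 :=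
      .of_step fun _ => rfl
    have h2 := h1.trans ((Prog.exec_pushList 0 acc σ).reaches [p])
    rw [hσ] at h2
    obtain ⟨t, ht, h⟩ := h2
    exact ⟨t, by omega, h⟩
  | succ d ih =>
    cases l with
    | nil => simp at hl
    | cons b l =>
      have h1 : Config.Reaches ⟨[Prog.lookup g p (d + 1) acc], σ⟩
          ⟨[Prog.lookup g p d (b :: acc)], Function.update σ 0 l⟩ 1 := by
        refine .of_step fun _ => ?_
        cases b <;> simp [Prog.lookup, Config.step, hσ]
      have h2 := h1.trans (ih (acc := b :: acc) (l := l) (by simp) (by simpa using hl))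
      rw [Function.update_idem, List.reverse_cons, List.append_assoc, List.singleton_append] at h2
      obtain ⟨t, ht, h⟩ := h2
      exact ⟨t, by simp at ht; omega, h⟩

/-- Since `transform` leaves all its working stacks empty, the next program starts in its genuine
initial configuration. -/
theorem Prog.init_eq_layout (M : Prog) (x : List Bool) :
    M.init x = ⟨[M], layout x [] [] 0 0 0⟩ := by
  rw [Prog.init]
  congr 1
  funext s
  unfold layout
  split_ifs <;> split <;> simp_all

/-- If `M` detects for all 3-CNFs with at least `m₀` clauses whether the acceptance probability of
the circuit vanishes, then some machine decides the gap, with a polynomial overhead. -/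
theorem exists_decidesGap (M : Prog) (T : ℕ → ℕ) (m₀ : ℕ)
    (hM : ∀ f : CNF3, f.n ≤ 3 * f.m → m₀ ≤ f.m → DetectsNonzero M f.circuit (T f.m)) :
    ∃ (M' : Prog) (C : ℕ), DecidesGap M' fun m => C + 100000 * (38 * m + 12) ^ 2 + T m := by
  classical
  -- One more than the bound of `CNF3.length_encode_le` at `m₀`, so descriptions of length at least
  -- `d` have at least `m₀` clauses.
  let d := 9 * m₀ ^ 2 + 10 * m₀ + 3
  -- No computability is needed: only the values on words shorter than `d` are built into the
  -- program.
  let g : List Bool → Bool := fun w => decide (∃ f : CNF3, f.encode.reverse = w ∧ f.gap ≠ 0)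
  let M' := Prog.lookup g (.seq .transform M) d []
  refine ⟨M', 3 * d + 10, fun f hf => ?_⟩
  suffices h : (M'.init f.encode).HaltsBy (3 * d + 10 + 100000 * (38 * f.m + 12) ^ 2 + T f.m) ∧
      ((M'.init f.encode).CanAccept ↔ f.gap ≠ 0) from
    ⟨Prog.haltsWithin_iff.2 h.1, (Prog.ndAccepts_iff h.1).trans h.2⟩
  by_cases hd : f.encode.length < d
  · have h1 := (Prog.exec_lookup_of_lt (g := g) (p := .seq .transform M) (acc := [])
      (σ := (M'.init f.encode).mem) rfl hd).reaches []
    have hg : g (f.encode.reverse ++ []) = true ↔ f.gap ≠ 0 := by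
      simp only [g, List.append_nil, decide_eq_true_eq, List.reverse_inj]
      constructor
      · rintro ⟨f', h, h'⟩
        rwa [← CNF3.encode_injective h]
      · exact fun h => ⟨f, rfl, h⟩
    have h0 : ∀ σ w, Config.run ⟨[], σ⟩ w = ⟨[], σ⟩ := fun σ w =>
      Config.run_halted (show Config.Halted ⟨[], σ⟩ from rfl) w
    have h2 : Config.HaltsBy ⟨[], Function.update (M'.init f.encode).mem 0
        [g (f.encode.reverse ++ [])]⟩ 0 := fun w _ => by
      rw [h0]; rfl
    refine ⟨(h1.haltsBy h2).mono (by omega), (h1.canAccept_iff).trans (Iff.trans ?_ hg)⟩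
    constructor
    · rintro ⟨w, hw⟩
      rw [h0] at hw
      simpa [Prog.init] using hw.2
    · intro h
      exact ⟨[], rfl, by simpa [Config.run, Prog.init] using h⟩
  · have hm : m₀ ≤ f.m := by
      by_contra hm
      have h1 := f.length_encode_le hf
      have h2 : f.m ^ 2 ≤ m₀ ^ 2 := Nat.pow_le_pow_left (by omega) 2
      omega
    obtain ⟨h1, h2⟩ := hM f hf hm
    rw [CNF3.encode_circuit] at h1 h2
    have h3 := Prog.reaches_lookup_of_le (g := g) (p := .seq .transform M) (acc := [])
      (σ := layout f.encode [] [] 0 0 0) rfl (not_lt.1 hd)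
    simp only [List.reverse_nil, List.nil_append, update_layout_zero] at h3
    have h4 : Config.Reaches ⟨[.seq .transform M], layout f.encode [] [] 0 0 0⟩
        ⟨[.transform, M], layout f.encode [] [] 0 0 0⟩ 1 := .of_step fun _ => rfl
    have h5 := (h3.trans h4).trans ((Prog.exec_transform f).reaches [M])
    rw [← Prog.init_eq_layout, ← Prog.init_eq_layout] at h5
    have hq : (f.qubits + 1) ^ 2 ≤ (38 * f.m + 12) ^ 2 :=
      Nat.pow_le_pow_left (by rw [CNF3.qubits]; omega) 2
    refine ⟨(h5.haltsBy h1).mono (by simp only [List.length_nil]; omega), ?_⟩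
    rw [h5.canAccept_iff, h2, CNF3.pacc_circuit_ne_zero_iff]

/-! ### Hard instances -/

/-- Some 3-CNF with `m` clauses has a circuit on which `M` fails in less than `2^{cm}` time. -/
def HasHardInstance (M : Prog) (c : ℝ) (m : ℕ) : Prop :=
  ∃ f : CNF3, f.m = m ∧ f.n ≤ 3 * f.m ∧
    ∀ T : ℕ, (T : ℝ) < (2 : ℝ) ^ (c * m) → ¬ DetectsNonzero M f.circuit T

open Filter Asymptotics in
theorem eventually_poly_add_lt (C : ℕ) {c : ℝ} (hc : 0 < c) :
    ∀ᶠ m : ℕ in atTop, ((C + 100000 * (38 * m + 12) ^ 2 : ℕ) : ℝ) + (2 : ℝ) ^ (c / 2 * m) <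
      (2 : ℝ) ^ (c * m) := by
  have hr : (1 : ℝ) < 2 ^ (c / 2) := Real.one_lt_rpow (by norm_num) (by positivity)
  -- For `m ≥ 1`, `(38m + 12)² ≤ 2500 m²`, so the polynomial is at most `(C + 250000000) m²`; the
  -- extra `1` makes it strictly less than `x = 2^{cm/2}`. Then `x ≥ 2` gives `x + x ≤ x²`.
  have hK : (0 : ℝ) < C + 250000001 := by positivity
  have h1 := (isLittleO_pow_const_const_pow_of_one_lt (R := ℝ) 2 hr).def (inv_pos.2 hK)
  have h2 : ∀ᶠ m : ℕ in atTop, (2 : ℝ) ≤ (2 ^ (c / 2)) ^ m :=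
    (tendsto_pow_atTop_atTop_of_one_lt hr).eventually_ge_atTop 2
  filter_upwards [h1, h2, eventually_ge_atTop 1] with m h1 h2 hm
  have hm' : (1 : ℝ) ≤ m := by exact_mod_cast hm
  have e1 : (2 : ℝ) ^ (c / 2 * m) = (2 ^ (c / 2)) ^ m := Real.rpow_mul_natCast (by norm_num) _ _
  have e2 : (2 : ℝ) ^ (c * m) = (2 ^ (c / 2)) ^ m * (2 ^ (c / 2)) ^ m := by
    rw [← e1, ← Real.rpow_add (by norm_num)]
    ring_nf
  rw [e1, e2]
  generalize ((2 : ℝ) ^ (c / 2)) ^ m = x at *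
  rw [Real.norm_of_nonneg (by positivity), Real.norm_of_nonneg (by linarith),
    ← div_eq_inv_mul, le_div_iff₀ hK] at h1
  have hC : (0 : ℝ) ≤ C := by positivity
  push_cast
  nlinarith [mul_nonneg hC (by nlinarith : (0 : ℝ) ≤ m ^ 2 - 1)]

-- If hard instances were eventually absent for every `c > 0`, the least time in which `M` handles
-- all formulas with `m` clauses would be eventually below every `2^{cm}`. This single bound plus a
-- polynomial overhead then contradicts the conjecture.
open Filter in
theorem exists_frequently_hasHardInstance (hconj : GapETHConjecture) (M : Prog) :
    ∃ c : ℝ, 0 < c ∧ ∃ᶠ m : ℕ in atTop, HasHardInstance M c m := by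
  by_contra! hcon
  have hcon : ∀ c : ℝ, 0 < c → ∀ᶠ m : ℕ in atTop, ¬ HasHardInstance M c m := by
    simpa only [not_frequently] using hcon
  let U : ℕ → Set ℕ := fun m =>
    {T | ∀ f : CNF3, f.m = m → f.n ≤ 3 * f.m → DetectsNonzero M f.circuit T}
  have hU : ∀ (c : ℝ) (m : ℕ), ¬ HasHardInstance M c m →
      ∃ T ∈ U m, (T : ℝ) ≤ (2 : ℝ) ^ (c * m) := by
    intro c m h
    refine ⟨⌊(2 : ℝ) ^ (c * m)⌋₊, fun f hf hn => ?_, Nat.floor_le (by positivity)⟩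
    simp only [HasHardInstance, not_exists, not_and, not_forall, not_not] at h
    obtain ⟨T, hT, h⟩ := h f hf hn
    exact h.mono (Nat.le_floor hT.le)
  obtain ⟨m₀, hm₀⟩ := eventually_atTop.1 (hcon 1 one_pos)
  -- Below `m₀` the set `U m` may be empty and its infimum `0`; those formulas are left to the
  -- lookup table.
  obtain ⟨M', C, hM'⟩ := exists_decidesGap M (fun m => sInf (U m)) m₀ fun f hf hm => by
    obtain ⟨T, hT, -⟩ := hU 1 f.m (hm₀ _ hm)
    exact Nat.sInf_mem ⟨T, hT⟩ f rfl hf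
  obtain ⟨c, hc, h⟩ := hconj M' _ hM'
  have hfalse := (h.and_eventually (hcon (c / 2) (by positivity))).and_eventually
    (eventually_poly_add_lt C hc)
  obtain ⟨m, ⟨h1, h2⟩, h3⟩ := hfalse.exists
  obtain ⟨T, hT, hT'⟩ := hU _ m h2
  have h4 : ((sInf (U m) : ℕ) : ℝ) ≤ T := by exact_mod_cast Nat.sInf_le hT
  rw [Nat.cast_add] at h1
  linarith

/-! ### Diagonalization -/

/-- Gödel numbers of programs. -/
def Prog.code : Prog → ℕ
  | .skip => Nat.pair 0 0
  | .push s b => Nat.pair 1 (Nat.pair s b.toNat)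
  | .pop s p q r => Nat.pair 2 (Nat.pair s (Nat.pair p.code (Nat.pair q.code r.code)))
  | .flip p q => Nat.pair 3 (Nat.pair p.code q.code)
  | .seq p q => Nat.pair 4 (Nat.pair p.code q.code)
  | .loop s p => Nat.pair 5 (Nat.pair s p.code)

theorem Prog.code_injective : Function.Injective Prog.code := by
  intro p
  induction p with
  | skip => intro p' h; cases p' <;> simp_all [Prog.code, Nat.pair_eq_pair]
  | push s b =>
    intro p' h
    cases p' with
    | push s' b' => cases b <;> cases b' <;> simp_all [Prog.code, Nat.pair_eq_pair]
    | _ => simp [Prog.code, Nat.pair_eq_pair] at h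
  | pop s p q r hp hq hr =>
    intro p' h
    cases p' <;> simp [Prog.code, Nat.pair_eq_pair] at h
    obtain ⟨rfl, h1, h2, h3⟩ := h
    rw [hp h1, hq h2, hr h3]
  | flip p q hp hq =>
    intro p' h
    cases p' <;> simp [Prog.code, Nat.pair_eq_pair] at h
    rw [hp h.1, hq h.2]
  | seq p q hp hq =>
    intro p' h
    cases p' <;> simp [Prog.code, Nat.pair_eq_pair] at h
    rw [hp h.1, hq h.2]
  | loop s p hp =>
    intro p' h
    cases p' <;> simp [Prog.code, Nat.pair_eq_pair] at h
    rw [h.1, hp h.2]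

instance : Countable Prog := Prog.code_injective.countable

instance : Nonempty Prog := ⟨.skip⟩

open Filter in
theorem SubExponential.eventually_lt {τ : ℕ → ℕ} (hτ : SubExponential τ) {c : ℝ} (hc : 0 < c) :
    ∀ᶠ m : ℕ in atTop, (τ (21 * m + 7) : ℝ) < (2 : ℝ) ^ (c * m) := by
  obtain ⟨g, hg, hτ⟩ := hτ
  -- For `m ≥ 1`, `21m + 7 ≤ 28m`, so the exponent is at most `cm/2`.
  have h1 := hg.def (show 0 < c / 56 by positivity)
  have h2 : Tendsto (fun m : ℕ => 21 * m + 7) atTop atTop :=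
    tendsto_atTop_mono (fun m => show m ≤ 21 * m + 7 by omega) tendsto_id
  filter_upwards [h2.eventually h1, eventually_ge_atTop 1] with m h1 hm
  have hm' : (1 : ℝ) ≤ m := by exact_mod_cast hm
  refine (hτ _).trans_lt (Real.rpow_lt_rpow_of_exponent_lt (by norm_num) ?_)
  rw [Real.norm_eq_abs, Real.norm_of_nonneg (by positivity)] at h1
  have h3 := (le_abs_self _).trans h1
  push_cast at h3
  nlinarith

end FineGrained

/-! ### The sequence of hard circuits -/

open FineGrained Filter in
theorem theorem7 (hconj : FineGrained.GapETHConjecture) :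
    ∃ (A : Set ℕ) (V : ℕ → FineGrained.CliffordT) (k : ℕ),
      A.Infinite ∧
      (∀ t ∈ A, (V t).tCount = t ∧ (V t).size ≤ t ^ k + k) ∧
      ∀ (ε : ℝ), ε < 1 → ∀ (M : FineGrained.Prog) (τ : ℕ → ℕ), FineGrained.SubExponential τ →
        {t ∈ A | ¬ FineGrained.Samples M (V t) (τ t) ε}.Infinite := by
  obtain ⟨e, he⟩ := exists_surjective_nat Prog
  choose c hc hfreq using exists_frequently_hasHardInstance hconj
  -- The `k`-th instance is hard for the program indexed by the first component of `Nat.unpair k`,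
  -- so every program is treated infinitely often, at strictly increasing numbers of clauses. The
  -- choice involves neither `ε` nor `τ`.
  obtain ⟨φ, hφ, hhard⟩ := extraction_forall_of_frequently
    fun k : ℕ => hfreq (e (Nat.unpair k).1)
  choose f hfm hfn hf using hhard
  have hinj : Function.Injective fun k => 21 * φ k + 7 :=
    fun a b h => hφ.injective (by simpa using h)
  -- The empty circuit is a default outside the index set. The value `100` is the additive constant
  -- of `CNF3.size_circuit_le`; as an exponent it is merely generous.
  refine ⟨Set.range fun k => 21 * φ k + 7,
    Function.extend (fun k => 21 * φ k + 7) (fun k => (f k).circuit) fun _ => ⟨0, []⟩, 100,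
    Set.infinite_range_of_injective hinj, ?_, ?_⟩
  · rintro _ ⟨k, rfl⟩
    dsimp only
    rw [hinj.extend_apply (fun k => (f k).circuit), CNF3.tCount_circuit, hfm]
    refine ⟨rfl, ((f k).size_circuit_le (hfn k)).trans ?_⟩
    rw [hfm]
    have h1 := Nat.pow_le_pow_right (show 0 < 21 * φ k + 7 by omega) (show 2 ≤ 100 by norm_num)
    have h2 : 300 * φ k ≤ (21 * φ k + 7) ^ 2 := by nlinarith [Nat.le_mul_self (φ k)]
    omega
  · intro ε hε M τ hτ
    obtain ⟨i, rfl⟩ := he M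
    have hpair : Tendsto (Nat.pair i) atTop atTop :=
      tendsto_atTop_mono (Nat.right_le_pair i) tendsto_id
    -- From the `J`-th instance treating this program on, `τ` lies below the time for which the
    -- instance is hard.
    obtain ⟨J, hJ⟩ := eventually_atTop.1
      ((hφ.tendsto_atTop.comp hpair).eventually (hτ.eventually_lt (hc (e i))))
    refine (Set.infinite_of_injective_forall_mem (f := fun j => 21 * φ (Nat.pair i (J + j)) + 7)
      (fun a b h => ?_) fun j => ⟨⟨_, rfl⟩, fun hs => ?_⟩)
    · have := Nat.pair_eq_pair.1 (hinj h)
      omega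
    · rw [hinj.extend_apply (fun k => (f k).circuit)] at hs
      refine hf (Nat.pair i (J + j)) (τ (21 * φ (Nat.pair i (J + j)) + 7)) ?_ ?_
      · simpa using hJ (J + j) (by omega)
      · simpa using hs.detectsNonzero hε
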